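/- Let $v_k=e^{2\pi i k/7}\in\mathbb{C}$ be the vertices of a regular heptagon. The diagonal from $v_2$ to $v_{-2}$ divides the heptagon into two parts; let $w_{\pm3}$ be the mirror images of $v_{\pm 3}$ in this diagonal, and let $T$ be the larger part with the mirror image of the smaller part removed, i.e. the closed region bounded by the equilateral heptagon $v_{-2}v_{-1}v_0v_1v_2w_3w_{-3}$ (inner angles $\frac{\pi}{7},\frac{5\pi}{7},\frac{5\pi}{7},\frac{5\pi}{7},\frac{\pi}{7},\frac{9\pi}{7},\frac{9\pi}{7}$). Let $T$ be decorated with a marked arc $a$: a simple arc in $T$ from the middle vertex $v_0$ of the convex side to the vertex $w_3$ of the concave side, whose points other than these two endpoints lie in the interior of $T$. Let $g_0,g_1,g_2,\dots$ be isometries of the plane (reflections allowed) such that the tiles $g_n(T)$ form a tiling: they cover the plane, and any two of them with different indices overlap in a set of area zero. Suppose that the tiles, placed in this order with $g_0(T)$ as seed, obey matching rule R1: for every $n\ge 1$ there is some $m<n$ such that the marked arcs $g_n(a)$ and $g_m(a)$ have a common endpoint. Then the union $C=\bigcup_n g_n(a)$ of all marked arcs is a continuous self-avoiding curve that reaches each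 tile: $C$ is the image of an injective continuous map $[0,\infty)\to\mathbb{C}$ or $\mathbb{R}\to\mathbb{C}$, and $C$ meets every $g_n(T)$. Moreover, the tiling is nonperiodic: no translation by a nonzero vector maps the set of tiles $\{g_n(T): n\ge 0\}$ onto itself. -/

import Mathlib

open Set MeasureTheory

namespace HeptagonTiling

noncomputable section

/-- The vertices `exp (2πik/7)` of a regular heptagon (indices modulo 7) in the plane `ℂ`. -/
def hept (k : ℤ) : ℂ := Complex.exp (2 * Real.pi * Complex.I * k / 7)

/-- The mirror image of the vertex `hept k` in the diagonal through `hept 2` and `hept (-2)`,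
which is the vertical line of abscissa `cos (4π/7)`. -/
def refl (k : ℤ) : ℂ := 2 * (Real.cos (4 * Real.pi / 7) : ℂ) - starRingEnd ℂ (hept k)

/-- The undecorated prototile: the diagonal from `hept 2` to `hept (-2)` cuts the regular heptagon
into two parts; the tile is the larger part with the mirror image of the smaller part removed (and
the boundary kept). In other words, it is the closed region bounded by the equilateral heptagon with
successive vertices `hept (-2)`, `hept (-1)`, `hept 0`, `hept 1`, `hept 2`, `refl 3`, `refl (-3)`
and inner angles `π/7`, `5π/7`, `5π/7`, `5π/7`, `π/7`, `9π/7`, `9π/7`. It is written here as a union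
of three convex polygons, cut along the segments from `refl (±3)` to `hept (±1)`. -/
def tile : Set ℂ :=
  convexHull ℝ {hept 2, hept 1, refl 3} ∪
  convexHull ℝ {refl 3, hept 1, hept 0, hept (-1), refl (-3)} ∪
  convexHull ℝ {refl (-3), hept (-1), hept (-2)}

/-- The two endpoints of the marked arc: the middle vertex of the convex side (inner angle `5π/7`)
and a vertex of the concave side (inner angle `9π/7`). The other choice `refl (-3)` is the mirror
image, that is, the decoration of a flipped copy. -/
def arcEnds : Set ℂ := {hept 0, refl 3}

/-- `a` is a marked arc of the tile: a simple arc crossing the tile from `hept 0` to `refl 3`,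
inside the tile except for its endpoints (for example the straight segment). -/
def IsMarkedArc (a : Set ℂ) : Prop :=
  ∃ γ : ℝ → ℂ, ContinuousOn γ (Icc 0 1) ∧ InjOn γ (Icc 0 1) ∧ γ '' Icc 0 1 = a ∧
    γ 0 = hept 0 ∧ γ 1 = refl 3 ∧ γ '' Ioo 0 1 ⊆ interior tile

/-- The copies `g n '' P` of the prototile `P` under the isometries `g n` (flips are allowed) form
a monohedral tiling: they cover the plane without overlaps of nonzero area. -/
structure IsTiling (P : Set ℂ) (g : ℕ → ℂ ≃ᵢ ℂ) : Prop where
  covers : ⋃ n, g n '' P = univ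
  no_overlap : ∀ m n, m ≠ n → volume (g m '' P ∩ g n '' P) = 0

/-- Matching rule R1. The tiles are placed in the order `0, 1, 2, …`, tile `0` being the seed. Each
additionally placed tile connects with its marked arc to the marked arc of an already placed tile,
that is, the two arcs have an endpoint in common. -/
def RuleR1 (g : ℕ → ℂ ≃ᵢ ℂ) : Prop :=
  ∀ n, 0 < n → ∃ m < n, (g n '' arcEnds ∩ g m '' arcEnds).Nonempty

/-- `C` is a continuous self-avoiding endless curve (with one or no starting point). -/
def IsSelfAvoidingCurve (C : Set ℂ) : Prop :=
  ∃ (I : Set ℝ) (γ : ℝ → ℂ), (I = Ici 0 ∨ I = univ) ∧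
    ContinuousOn γ I ∧ InjOn γ I ∧ γ '' I = C

/-- The tiling by the copies `g n '' P`, with marked arcs `g n '' a`, is a monohedral tiling whose
marked arcs form a continuous self-avoiding curve that reaches each tile. -/
structure GeneratesCurve (P a : Set ℂ) (g : ℕ → ℂ ≃ᵢ ℂ) : Prop where
  tiling : IsTiling P g
  curve : IsSelfAvoidingCurve (⋃ n, g n '' a)
  reaches : ∀ n, ((⋃ m, g m '' a) ∩ g n '' P).Nonempty

/-- A family of tiles is nonperiodic if no translation by a nonzero vector leaves it unchanged. -/
def Nonperiodic (T : Set (Set ℂ)) : Prop :=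
  ∀ τ : ℂ, τ ≠ 0 → (fun S : Set ℂ => (fun z => z + τ) '' S) '' T ≠ T

end

end HeptagonTiling

/-! ### Unit complex numbers and circular sectors. -/

namespace HeptagonTiling
noncomputable section

open ComplexConjugate

/-! Call `hept 0`, `refl 3` and `refl (-3)` the ports of the tile; the marked arc ends at two of
them. The inner angle is 5π/7 at `hept 0` and 9π/7 at the other two, which are the corners of the
notch. As 5π/7 > 2π/3, no three tiles share a port; as 9π/7 > π, two notch corners never coincide. A
port of another tile lying at a notch corner is therefore its corner `hept 0`, and since 5π/7 + 9π/7
= 2π it fits exactly. Tiles so placed at the two notch corners would overlap, so only one tile can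
have ports in the notch. Each tile thus has at most two neighbours in the graph of shared ports, one
at `hept 0` and one in the notch (`IsTiling.atMostTwo`).

Rule R1 makes the graph of shared arc ends connected. Being infinite with degrees at most 2, it is a
one-way or two-way infinite path (`exists_path`). Arcs of different tiles meet only at common ends,
and no end belongs to three tiles, so joining the arcs along the path gives an injective curve
(`IsTiling.isSelfAvoidingCurve`).

A translation by τ ≠ 0 preserving the tiling permutes the tiles. The only nontrivial symmetry of the
tile is its reflection, which preserves the set of ports, so the permutation is an automorphism of
the port graph. Neither it nor its square has a fixed vertex, so it acts on the path as a shift and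
has finitely many orbits (`exists_finite_orbits`). All tiles then lie in a region bounded in a
direction normal to τ and cannot cover the plane (`IsTiling.nonperiodic`). -/

/-- The unit complex number of argument `θ`. -/
def cis (θ : ℝ) : ℂ := Complex.exp (θ * Complex.I)

lemma cis_add (x y : ℝ) : cis (x + y) = cis x * cis y := by
  simp [cis, add_mul, Complex.exp_add]

@[simp] lemma cis_re (θ : ℝ) : (cis θ).re = Real.cos θ := by
  simp [cis, Complex.exp_ofReal_mul_I_re]

@[simp] lemma cis_im (θ : ℝ) : (cis θ).im = Real.sin θ := by
  simp [cis, Complex.exp_ofReal_mul_I_im]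

@[simp] lemma norm_cis (θ : ℝ) : ‖cis θ‖ = 1 := Complex.norm_exp_ofReal_mul_I θ

lemma conj_cis (θ : ℝ) : conj (cis θ) = cis (-θ) := by
  apply Complex.ext <;> simp

lemma cis_add_two_pi (θ : ℝ) : cis (θ + 2 * Real.pi) = cis θ := by
  apply Complex.ext <;> simp

lemma cis_sub_two_pi (θ : ℝ) : cis (θ - 2 * Real.pi) = cis θ := by
  apply Complex.ext <;> simp

lemma cis_add_pi (θ : ℝ) : cis (θ + Real.pi) = -cis θ := by
  apply Complex.ext <;> simp

/-- A chord of the unit circle in polar form. -/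
lemma cis_sub_cis (x y : ℝ) :
    cis x - cis y = (2 * Real.sin ((x - y) / 2) : ℝ) * cis ((x + y) / 2 + Real.pi / 2) := by
  apply Complex.ext
  · rw [Complex.re_ofReal_mul, Complex.sub_re, cis_re, cis_re, cis_re, Real.cos_sub_cos,
      Real.cos_add_pi_div_two]
    ring
  · rw [Complex.im_ofReal_mul, Complex.sub_im, cis_im, cis_im, cis_im, Real.sin_sub_sin,
      Real.sin_add_pi_div_two]

lemma cis_add_cis (x y : ℝ) :
    cis x + cis y = (2 * Real.cos ((x - y) / 2) : ℝ) * cis ((x + y) / 2) := by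
  apply Complex.ext
  · rw [Complex.re_ofReal_mul, Complex.add_re, cis_re, cis_re, cis_re, Real.cos_add_cos]
    ring
  · rw [Complex.im_ofReal_mul, Complex.add_im, cis_im, cis_im, cis_im]
    have h := Real.sin_sub_sin x (-y)
    rw [Real.sin_neg, sub_neg_eq_add, sub_neg_eq_add, ← sub_eq_add_neg] at h
    rw [h]; ring

/-- Cramer's rule in the basis `cis a`, `cis b`. For a ≤ θ ≤ b < a + π the coefficients are
nonnegative, which yields barycentric coordinates in `sector_subset_triangle`. -/
lemma cis_comb (a b θ : ℝ) :
    (Real.sin (b - a) : ℂ) * cis θ = Real.sin (b - θ) * cis a + Real.sin (θ - a) * cis b := by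
  apply Complex.ext
  · rw [Complex.re_ofReal_mul, Complex.add_re, Complex.re_ofReal_mul, Complex.re_ofReal_mul]
    simp only [cis_re, Real.sin_sub]; ring
  · rw [Complex.im_ofReal_mul, Complex.add_im, Complex.im_ofReal_mul, Complex.im_ofReal_mul]
    simp only [cis_im, Real.sin_sub]; ring

lemma Convex.combo_three_mem {S : Set ℂ} (hS : Convex ℝ S) {x y z : ℂ} (hx : x ∈ S) (hy : y ∈ S)
    (hz : z ∈ S) {u s t : ℝ} (hu : 0 ≤ u) (hs : 0 ≤ s) (ht : 0 ≤ t) (h : u + s + t = 1) :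
    u * x + s * y + t * z ∈ S := by
  have := hS.sum_mem (t := Finset.univ) (w := ![u, s, t]) (z := ![x, y, z])
    (by intro i _; fin_cases i <;> simpa) (by simpa [Fin.sum_univ_three] using h)
    (by intro i _; fin_cases i <;> simpa)
  simpa [Fin.sum_univ_three] using this

/-- A triangle contains a small closed circular sector at each of its corners. -/
lemma sector_subset_triangle (p : ℂ) {a b ρ ρ' : ℝ} (hab : a < b) (hb : b < a + Real.pi)
    (hρ : 0 < ρ) (hρ' : 0 < ρ') :
    ∃ r₀ > 0, ∀ r : ℝ, 0 ≤ r → r < r₀ → ∀ θ ∈ Icc a b,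
      p + r * cis θ ∈ convexHull ℝ {p, p + ρ * cis a, p + ρ' * cis b} := by
  have hs : 0 < Real.sin (b - a) := Real.sin_pos_of_pos_of_lt_pi (by linarith) (by linarith)
  -- This radius keeps the weights `s` and `t` of the two far corners at most 1/2, so the weight of
  -- `p` stays nonnegative.
  refine ⟨Real.sin (b - a) * min ρ ρ' / 2, by positivity, fun r hr hr' θ hθ => ?_⟩
  have h1 : 0 ≤ Real.sin (b - θ) :=
    Real.sin_nonneg_of_nonneg_of_le_pi (by linarith [hθ.2]) (by linarith [hθ.1])
  have h2 : 0 ≤ Real.sin (θ - a) :=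
    Real.sin_nonneg_of_nonneg_of_le_pi (by linarith [hθ.1]) (by linarith [hθ.2])
  have h1' := Real.sin_le_one (b - θ)
  have h2' := Real.sin_le_one (θ - a)
  set s := r * Real.sin (b - θ) / (Real.sin (b - a) * ρ) with hs_def
  set t := r * Real.sin (θ - a) / (Real.sin (b - a) * ρ') with ht_def
  have hs0 : 0 ≤ s := by positivity
  have ht0 : 0 ≤ t := by positivity
  have hs1 : s ≤ 1 / 2 := by
    rw [hs_def, div_le_iff₀ (by positivity)]
    nlinarith [min_le_left ρ ρ', mul_le_mul_of_nonneg_left h1' hr,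
      mul_le_mul_of_nonneg_left (min_le_left ρ ρ') hs.le]
  have ht1 : t ≤ 1 / 2 := by
    rw [ht_def, div_le_iff₀ (by positivity)]
    nlinarith [min_le_right ρ ρ', mul_le_mul_of_nonneg_left h2' hr,
      mul_le_mul_of_nonneg_left (min_le_right ρ ρ') hs.le]
  have e : p + r * cis θ = (1 - s - t : ℝ) * p + s * (p + ρ * cis a) + t * (p + ρ' * cis b) := by
    have h := cis_comb a b θ
    have hs' : (Real.sin (b - a) : ℂ) ≠ 0 := by exact_mod_cast hs.ne'
    have hρ1 : (ρ : ℂ) ≠ 0 := by exact_mod_cast hρ.ne'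
    have hρ2 : (ρ' : ℂ) ≠ 0 := by exact_mod_cast hρ'.ne'
    have h3 : cis θ = (Real.sin (b - θ) * cis a + Real.sin (θ - a) * cis b) / Real.sin (b - a) := by
      rw [← h]; field_simp
    rw [h3, hs_def, ht_def]
    simp only [Complex.ofReal_sub, Complex.ofReal_div, Complex.ofReal_mul, Complex.ofReal_one]
    field_simp
    ring
  rw [e]
  refine Convex.combo_three_mem (convex_convexHull ℝ _) ?_ ?_ ?_ (by linarith) hs0 ht0 (by ring) <;>
    exact subset_convexHull ℝ _ (by simp)

/-- `A` contains, near `p`, the open circular sector at `p` around the direction `e` (a unit complex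
number) of half-angle `β`. -/
def HasSector (A : Set ℂ) (p e : ℂ) (β : ℝ) : Prop :=
  ∃ r > 0, ∀ z : ℂ, ‖z‖ < r → Real.cos β * ‖z‖ < (z * conj e).re → p + z ∈ A

lemma HasSector.mono {A B : Set ℂ} {p e : ℂ} {β γ : ℝ} (h : HasSector A p e β) (hAB : A ⊆ B)
    (hc : Real.cos β ≤ Real.cos γ) : HasSector B p e γ := by
  obtain ⟨r, hr, H⟩ := h
  exact ⟨r, hr, fun z hz hz' => hAB (H z hz
    (lt_of_le_of_lt (mul_le_mul_of_nonneg_right hc (norm_nonneg z)) hz'))⟩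

/-- Sectors are open cones near their apex: a common direction `z`, scaled into both radii, gives an
interior point of the intersection. -/
lemma HasSector.interior_inter {A B : Set ℂ} {p e e' : ℂ} {β β' : ℝ} (hA : HasSector A p e β)
    (hB : HasSector B p e' β') {z : ℂ} (hz : Real.cos β * ‖z‖ < (z * conj e).re)
    (hz' : Real.cos β' * ‖z‖ < (z * conj e').re) : (interior (A ∩ B)).Nonempty := by
  obtain ⟨r, hr, HA⟩ := hA
  obtain ⟨r', hr', HB⟩ := hB
  have hz0 : 0 < ‖z‖ := by
    rw [norm_pos_iff]; rintro rfl; simp at hz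
  set ρ := min r r' / (2 * ‖z‖) with hρ
  have hρ0 : 0 < ρ := by positivity
  have hρz : ‖(ρ : ℂ) * z‖ = min r r' / 2 := by
    rw [norm_mul, Complex.norm_real, Real.norm_of_nonneg hρ0.le, hρ]; field_simp
  have hm : 0 < min r r' := by positivity
  let U : Set ℂ := {w | ‖w - p‖ < min r r' ∧ Real.cos β * ‖w - p‖ < ((w - p) * conj e).re ∧
    Real.cos β' * ‖w - p‖ < ((w - p) * conj e').re}
  have hU : IsOpen U := by
    have h1 : Continuous fun w : ℂ => ‖w - p‖ := by fun_prop
    have h2 : ∀ d : ℂ, Continuous fun w : ℂ => ((w - p) * conj d).re := fun d => by fun_prop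
    exact (isOpen_lt h1 continuous_const).inter
      ((isOpen_lt (continuous_const.mul h1) (h2 e)).inter
        (isOpen_lt (continuous_const.mul h1) (h2 e')))
  refine ⟨p + ρ * z, mem_interior.2 ⟨U, fun w hw => ?_, hU, ?_, ?_, ?_⟩⟩
  · have e1 : p + (w - p) = w := by ring
    exact ⟨e1 ▸ HA _ (hw.1.trans_le (min_le_left _ _)) hw.2.1,
      e1 ▸ HB _ (hw.1.trans_le (min_le_right _ _)) hw.2.2⟩
  · rw [add_sub_cancel_left, hρz]; linarith
  · rw [add_sub_cancel_left, mul_assoc, Complex.re_ofReal_mul, norm_mul, Complex.norm_real,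
      Real.norm_of_nonneg hρ0.le]
    nlinarith
  · rw [add_sub_cancel_left, mul_assoc, Complex.re_ofReal_mul, norm_mul, Complex.norm_real,
      Real.norm_of_nonneg hρ0.le]
    nlinarith

lemma hasSector_of_angles {A : Set ℂ} {p : ℂ} {φ β r₀ : ℝ} (hr₀ : 0 < r₀) (hβ : 0 ≤ β)
    (h : ∀ r : ℝ, 0 ≤ r → r < r₀ → ∀ θ ∈ Icc (φ - β) (φ + β), p + r * cis θ ∈ A) :
    HasSector A p (cis φ) β := by
  refine ⟨r₀, hr₀, fun z hz hz' => ?_⟩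
  have hw : z * conj (cis φ) = ‖z‖ * cis (Complex.arg (z * conj (cis φ))) := by
    have := Complex.norm_mul_exp_arg_mul_I (z * conj (cis φ))
    rw [norm_mul, RCLike.norm_conj, norm_cis, mul_one] at this
    exact this.symm
  set ψ := Complex.arg (z * conj (cis φ)) with hψ
  have hz1 : z = ‖z‖ * cis (φ + ψ) := by
    have : z * conj (cis φ) * cis φ = z := by
      rw [conj_cis, mul_assoc, ← cis_add]; simp [cis]
    calc z = z * conj (cis φ) * cis φ := this.symm
      _ = ‖z‖ * cis (φ + ψ) := by rw [hw, cis_add]; ring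
  have hz0 : 0 < ‖z‖ := by
    rw [norm_pos_iff]; rintro rfl; simp at hz'
  rw [hw, Complex.re_ofReal_mul, cis_re, mul_comm, mul_lt_mul_iff_right₀ hz0] at hz'
  have hψβ : |ψ| ≤ β := by
    by_contra hcon
    push Not at hcon
    have := Real.cos_le_cos_of_nonneg_of_le_pi hβ (Complex.abs_arg_le_pi _) hcon.le
    rw [← hψ, Real.cos_abs] at this
    linarith
  rw [hz1]
  exact h _ (norm_nonneg z) hz _ ⟨by linarith [(abs_le.1 hψβ).1], by linarith [(abs_le.1 hψβ).2]⟩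

/-- Two of three unit vectors form an angle of at most `2π/3`, so that two of three sectors of
half-angle more than `π/3` at the same point overlap. -/
lemma HasSector.two_of_three {A : Fin 3 → Set ℂ} {p : ℂ} {e : Fin 3 → ℂ} {β : ℝ}
    (hβ : Real.cos β < 1 / 2) (he : ∀ i, ‖e i‖ = 1) (h : ∀ i, HasSector (A i) p (e i) β) :
    ∃ i j, i ≠ j ∧ (interior (A i ∩ A j)).Nonempty := by
  have key : ∀ i j, -(1 / 2) ≤ (e i * conj (e j)).re → (interior (A i ∩ A j)).Nonempty := by
    intro i j hij
    have hi : (e i).re ^ 2 + (e i).im ^ 2 = 1 := by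
      have := Complex.sq_norm (e i); rw [he, Complex.normSq_apply] at this; linarith
    have hj : (e j).re ^ 2 + (e j).im ^ 2 = 1 := by
      have := Complex.sq_norm (e j); rw [he, Complex.normSq_apply] at this; linarith
    simp only [Complex.mul_re, Complex.conj_re, Complex.conj_im] at hij
    set c := (e i).re * (e j).re + (e i).im * (e j).im with hc
    have hn : ‖e i + e j‖ ^ 2 = 2 + 2 * c := by
      rw [Complex.sq_norm, Complex.normSq_apply, Complex.add_re, Complex.add_im]; linarith
    have hc' : -(1 / 2) ≤ c := by linarith
    -- The bisector `e i + e j` has inner product 1 + c = ‖e i + e j‖² / 2 with both axes, which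
    -- beats cos β · ‖e i + e j‖ once this norm is at least 1.
    have hn1 : 1 ≤ ‖e i + e j‖ := by
      by_contra hcon; nlinarith [norm_nonneg (e i + e j)]
    have hlt : Real.cos β * ‖e i + e j‖ < 1 + c := by nlinarith
    refine (h i).interior_inter (h j) (z := e i + e j) ?_ ?_ <;>
    · refine hlt.trans_le (le_of_eq ?_)
      simp only [Complex.mul_re, Complex.conj_re, Complex.conj_im, Complex.add_re, Complex.add_im]
      linarith
  by_contra hcon
  push Not at hcon
  have hk : ∀ i j, i ≠ j → (e i * conj (e j)).re < -(1 / 2) := by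
    intro i j hij
    by_contra h'
    exact (key i j (not_lt.1 h')).ne_empty (hcon i j hij)
  have h01 := hk 0 1 (by decide)
  have h02 := hk 0 2 (by decide)
  have h12 := hk 1 2 (by decide)
  have hs : ∀ i, (e i).re ^ 2 + (e i).im ^ 2 = 1 := by
    intro i
    have := Complex.sq_norm (e i); rw [he, Complex.normSq_apply] at this; linarith
  simp only [Complex.mul_re, Complex.conj_re, Complex.conj_im] at h01 h02 h12
  -- The squared norm 3 + 2(sum of the three inner products) of the sum of the vectors would be
  -- negative.
  nlinarith [hs 0, hs 1, hs 2, sq_nonneg ((e 0).re + (e 1).re + (e 2).re),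
    sq_nonneg ((e 0).im + (e 1).im + (e 2).im)]

/-- Two sectors of more than a half-plane overlap. -/
lemma HasSector.overlap_of_reflex {A B : Set ℂ} {p e e' : ℂ} {β : ℝ} (hβ : Real.cos β < 0)
    (he : ‖e‖ = 1) (he' : ‖e'‖ = 1)
    (hA : HasSector A p e β) (hB : HasSector B p e' β) : (interior (A ∩ B)).Nonempty := by
  have hs : ∀ e : ℂ, ‖e‖ = 1 → e.re ^ 2 + e.im ^ 2 = 1 := by
    intro e he
    have := Complex.sq_norm e; rw [he, Complex.normSq_apply] at this; linarith
  by_cases hee : e = e'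
  · subst hee
    have : Real.cos β * ‖e‖ < (e * conj e).re := by
      have := hs e he
      simp only [Complex.mul_re, Complex.conj_re, Complex.conj_im]
      rw [he]; linarith
    exact hA.interior_inter hB this this
  have h0 : 0 < ‖e - e'‖ := norm_pos_iff.2 (sub_ne_zero.2 hee)
  -- The direction ±i(e - e') has equal inner products with both axes, and the sign can make them
  -- nonnegative. Unlike e + e', it does not vanish for opposite axes.
  set d := e.im * e'.re - e.re * e'.im with hd
  have h1 : ((Complex.I * (e - e')) * conj e).re = -d := by
    simp [hd]; ring
  have h2 : ((Complex.I * (e - e')) * conj e').re = -d := by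
    simp [hd]; ring
  have h3 : Real.cos β * ‖e - e'‖ < 0 := mul_neg_of_neg_of_pos hβ h0
  rcases le_total d 0 with h | h
  · refine hA.interior_inter hB (z := Complex.I * (e - e')) ?_ ?_
    · rw [h1, norm_mul, Complex.norm_I, one_mul]; linarith
    · rw [h2, norm_mul, Complex.norm_I, one_mul]; linarith
  · refine hA.interior_inter hB (z := -(Complex.I * (e - e'))) ?_ ?_
    · rw [neg_mul, Complex.neg_re, h1, norm_neg, norm_mul, Complex.norm_I, one_mul]; linarith
    · rw [neg_mul, Complex.neg_re, h2, norm_neg, norm_mul, Complex.norm_I, one_mul]; linarith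

/-- If two sectors with half-angles adding up to `π` do not overlap, then they are opposite. -/
lemma HasSector.eq_neg_of_disjoint {A B : Set ℂ} {p e e' : ℂ} {β : ℝ} (hβ : 0 < β)
    (hβ' : β < Real.pi / 2) (he : ‖e‖ = 1) (he' : ‖e'‖ = 1)
    (hA : HasSector A p e (Real.pi - β)) (hB : HasSector B p e' β)
    (hAB : interior (A ∩ B) = ∅) : e' = -e := by
  have hs : ∀ e : ℂ, ‖e‖ = 1 → e.re ^ 2 + e.im ^ 2 = 1 := by
    intro e he
    have := Complex.sq_norm e; rw [he, Complex.normSq_apply] at this; linarith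
  have hcβ : 0 < Real.cos β := Real.cos_pos_of_mem_Ioo ⟨by linarith, hβ'⟩
  have hse := hs e he
  have hse' := hs e' he'
  -- Every direction inside the sector of `B` must avoid that of `A`. Letting γ tend to ±β and
  -- adding the two limit inequalities forces the inner product of `e` and `e'` down to -1.
  have key : ∀ γ ∈ Ioo (-β) β, (e' * conj e * cis γ).re ≤ -Real.cos β := by
    intro γ hγ
    by_contra hcon
    push Not at hcon
    have hγβ : |γ| < β := abs_lt.2 hγ
    have hcos : Real.cos β < Real.cos γ := by
      rw [← Real.cos_abs γ]
      exact Real.cos_lt_cos_of_nonneg_of_le_pi (abs_nonneg _) (by linarith) hγβ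
    refine (hA.interior_inter hB (z := e' * cis γ) ?_ ?_).ne_empty hAB
    · rw [Real.cos_pi_sub, norm_mul, he', norm_cis]
      have : e' * cis γ * conj e = e' * conj e * cis γ := by ring
      rw [this]; linarith
    · rw [norm_mul, he', norm_cis]
      have : e' * cis γ * conj e' = cis γ := by
        have := Complex.mul_conj e'
        rw [Complex.normSq_eq_norm_sq, he'] at this
        calc _ = (e' * conj e') * cis γ := by ring
          _ = _ := by rw [this]; simp
      rw [this, cis_re]; linarith
  have hcont : Continuous fun γ : ℝ => (e' * conj e * cis γ).re := by
    unfold cis; fun_prop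
  have hcl : ∀ γ ∈ Icc (-β) β, (e' * conj e * cis γ).re ≤ -Real.cos β := by
    rw [← closure_Ioo (by linarith : -β ≠ β)]
    exact fun γ hγ => closure_minimal (s := Ioo (-β) β) key
      (isClosed_le hcont continuous_const) hγ
  have h1 := hcl β ⟨by linarith, le_rfl⟩
  have h2 := hcl (-β) ⟨le_rfl, by linarith⟩
  simp only [Complex.mul_re, Complex.mul_im, Complex.conj_re, Complex.conj_im, cis_re, cis_im,
    Real.cos_neg, Real.sin_neg] at h1 h2
  have h3 : e'.re * e.re + e'.im * e.im ≤ -1 := by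
    by_contra hcon
    push Not at hcon
    nlinarith
  apply Complex.ext <;> simp only [Complex.neg_re, Complex.neg_im]
  · nlinarith [sq_nonneg (e'.re + e.re), sq_nonneg (e'.im + e.im)]
  · nlinarith [sq_nonneg (e'.re + e.re), sq_nonneg (e'.im + e.im)]

end
end HeptagonTiling

/-! ### The tile: vertices, corners and the notch. -/

namespace HeptagonTiling
noncomputable section

open ComplexConjugate Real

lemma hept_eq (k : ℤ) : hept k = cis (2 * π * k / 7) := by
  unfold hept cis; congr 1; push_cast; ring

lemma hept_zero : hept 0 = 1 := by simp [hept]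

lemma hept_neg (k : ℤ) : hept (-k) = conj (hept k) := by
  rw [hept_eq, hept_eq, conj_cis]; congr 1; push_cast; ring

lemma refl_neg (k : ℤ) : refl (-k) = conj (refl k) := by
  rw [refl, refl, hept_neg, map_sub, map_mul, Complex.conj_ofReal, map_ofNat]

lemma refl_eq (k : ℤ) : refl k = (2 * Real.cos (4 * π / 7) : ℝ) - cis (-(2 * π * k / 7)) := by
  rw [refl, hept_eq, conj_cis]; push_cast; rfl

lemma refl_two : refl 2 = hept 2 := by
  rw [refl_eq, hept_eq]
  have e : (2 * π * (2 : ℤ) / 7 : ℝ) = 4 * π / 7 := by push_cast; ring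
  rw [e]
  apply Complex.ext
  · rw [Complex.sub_re, Complex.ofReal_re, cis_re, cis_re, Real.cos_neg]; ring
  · rw [Complex.sub_im, Complex.ofReal_im, cis_im, cis_im, Real.sin_neg]; ring

/-- Edge length. -/
def edge : ℝ := 2 * Real.sin (π / 7)

lemma edge_pos : 0 < edge :=
  mul_pos two_pos (Real.sin_pos_of_pos_of_lt_pi (by positivity) (by linarith [pi_pos]))

lemma hept_one_eq : hept 1 = hept 0 + edge * cis (9 * π / 14) := by
  have h := cis_sub_cis (2 * π * (1 : ℤ) / 7) (2 * π * (0 : ℤ) / 7)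
  rw [← hept_eq, ← hept_eq, sub_eq_iff_eq_add'] at h
  have e1 : (2 * π * (1 : ℤ) / 7 - 2 * π * (0 : ℤ) / 7) / 2 = π / 7 := by push_cast; ring
  have e2 : (2 * π * (1 : ℤ) / 7 + 2 * π * (0 : ℤ) / 7) / 2 + π / 2 = 9 * π / 14 := by
    push_cast; ring
  rw [h, edge, e1, e2]

lemma hept_neg_one_eq : hept (-1) = hept 0 + edge * cis (19 * π / 14) := by
  rw [hept_neg, hept_one_eq, map_add, map_mul, Complex.conj_ofReal, ← hept_neg, neg_zero, conj_cis,
    ← cis_add_two_pi]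
  congr 3; ring

lemma hept_two_eq : hept 2 = refl 3 + edge * cis (11 * π / 14) := by
  have h := cis_sub_cis (-(2 * π * (3 : ℤ) / 7)) (-(2 * π * (2 : ℤ) / 7))
  have e1 : (-(2 * π * (3 : ℤ) / 7) - -(2 * π * (2 : ℤ) / 7)) / 2 = -(π / 7) := by push_cast; ring
  have e2 : (-(2 * π * (3 : ℤ) / 7) + -(2 * π * (2 : ℤ) / 7)) / 2 + π / 2 =
    11 * π / 14 - π := by push_cast; ring
  have e3 : cis (11 * π / 14 - π) = - cis (11 * π / 14) := by
    rw [← neg_eq_iff_eq_neg, ← cis_add_pi]; congr 1; ring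
  rw [e1, e2, e3, Real.sin_neg] at h
  rw [← refl_two, refl_eq, refl_eq, edge]
  rw [sub_eq_iff_eq_add] at h
  rw [h]; push_cast; ring

lemma refl_neg_three_eq : refl (-3) = refl 3 + edge * cis (-(π / 2)) := by
  have h := cis_sub_cis (-(2 * π * (3 : ℤ) / 7)) (2 * π * (3 : ℤ) / 7)
  have e1 : (-(2 * π * (3 : ℤ) / 7) - (2 * π * (3 : ℤ) / 7)) / 2 = -(π - π / 7) := by
    push_cast; ring
  have e2 : (-(2 * π * (3 : ℤ) / 7) + (2 * π * (3 : ℤ) / 7)) / 2 + π / 2 =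
    -(π / 2) + π := by push_cast; ring
  rw [e1, e2, cis_add_pi, Real.sin_neg, Real.sin_pi_sub] at h
  have e4 : (-(2 * π * (-3 : ℤ) / 7) : ℝ) = 2 * π * (3 : ℤ) / 7 := by push_cast; ring
  rw [refl_eq, refl_eq, edge, e4]
  rw [sub_eq_iff_eq_add] at h
  rw [h]; push_cast; ring

/-- The triangle `refl 3`, `hept 2`, `hept 1` is isosceles with apex angle π/7, so its base is the
sum of two edge vectors of equal length. -/
lemma hept_one_eq' : hept 1 = refl 3 + (edge * (2 * Real.cos (3 * π / 7)) : ℝ) * cis (5 * π / 14) := by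
  have h := cis_sub_cis (2 * π * (1 : ℤ) / 7) (2 * π * (2 : ℤ) / 7)
  have e1 : ((2 * π * (1 : ℤ) / 7) - (2 * π * (2 : ℤ) / 7)) / 2 = -(π / 7) := by push_cast; ring
  have e2 : ((2 * π * (1 : ℤ) / 7) + (2 * π * (2 : ℤ) / 7)) / 2 + π / 2 = -(π / 14) + π := by
    push_cast; ring
  rw [e1, e2, cis_add_pi, Real.sin_neg, ← hept_eq, ← hept_eq, sub_eq_iff_eq_add, hept_two_eq] at h
  have h' := cis_add_cis (-(π / 14)) (11 * π / 14)
  have e3 : (-(π / 14) - 11 * π / 14) / 2 = -(3 * π / 7) := by ring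
  have e4 : (-(π / 14) + 11 * π / 14) / 2 = 5 * π / 14 := by ring
  rw [e3, e4, Real.cos_neg] at h'
  rw [h, Complex.ofReal_mul edge, mul_assoc, ← h', edge]; push_cast; ring

lemma hept_neg_two_eq :
    hept (-2) = refl 3 + (edge * (2 * Real.cos (π / 7)) : ℝ) * cis (-(9 * π / 14)) := by
  have h := hept_two_eq
  have h' := cis_add_cis (-(11 * π / 14)) (-(π / 2))
  have e3 : (-(11 * π / 14) - -(π / 2)) / 2 = -(π / 7) := by ring
  have e4 : (-(11 * π / 14) + -(π / 2)) / 2 = -(9 * π / 14) := by ring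
  rw [e3, e4, Real.cos_neg] at h'
  rw [hept_neg, h, Complex.ofReal_mul, mul_assoc, ← h', map_add, map_mul, Complex.conj_ofReal,
    conj_cis, ← refl_neg, refl_neg_three_eq]; ring

lemma hull_subset_tile_zero : convexHull ℝ {hept 0, hept 1, hept (-1)} ⊆ tile := by
  refine Subset.trans (convexHull_mono ?_) (subset_union_right.trans subset_union_left)
  intro x; simp only [mem_insert_iff, mem_singleton_iff]; tauto

lemma hull_subset_tile_two : convexHull ℝ {refl 3, hept 1, hept 2} ⊆ tile := by
  refine Subset.trans (convexHull_mono ?_) (subset_union_left.trans subset_union_left)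
  intro x; simp only [mem_insert_iff, mem_singleton_iff]; tauto

lemma hull_subset_tile_three : convexHull ℝ {refl 3, refl (-3), hept 1} ⊆ tile := by
  refine Subset.trans (convexHull_mono ?_) (subset_union_right.trans subset_union_left)
  intro x; simp only [mem_insert_iff, mem_singleton_iff]; tauto

lemma image_conj_convexHull (s : Set ℂ) : conj '' convexHull ℝ s = convexHull ℝ (conj '' s) := by
  exact LinearMap.image_convexHull (Complex.conjLIE.toLinearEquiv.toLinearMap) s

lemma image_conj_tile : conj '' tile = tile := by
  unfold tile
  rw [image_union, image_union, image_conj_convexHull, image_conj_convexHull,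
    image_conj_convexHull]
  simp only [image_insert_eq, image_singleton, ← hept_neg, ← refl_neg, neg_neg, neg_zero]
  have h1 : ({hept (-2), hept (-1), refl (-3)} : Set ℂ) = {refl (-3), hept (-1), hept (-2)} := by
    ext x; simp only [mem_insert_iff, mem_singleton_iff]; tauto
  have h2 : ({refl (-3), hept (-1), hept 0, hept 1, refl 3} : Set ℂ) =
      {refl 3, hept 1, hept 0, hept (-1), refl (-3)} := by
    ext x; simp only [mem_insert_iff, mem_singleton_iff]; tauto
  have h3 : ({refl 3, hept 1, hept 2} : Set ℂ) = {hept 2, hept 1, refl 3} := by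
    ext x; simp only [mem_insert_iff, mem_singleton_iff]; tauto
  rw [h1, h2, h3]
  ext x; simp only [mem_union]; tauto

lemma tile_hasSector_zero : HasSector tile (hept 0) (cis π) (5 * π / 14) := by
  obtain ⟨r, hr, h⟩ := sector_subset_triangle (hept 0) (a := 9 * π / 14) (b := 19 * π / 14)
    (by linarith [pi_pos]) (by linarith [pi_pos]) edge_pos edge_pos
  rw [← hept_one_eq, ← hept_neg_one_eq] at h
  refine hasSector_of_angles hr (by positivity) fun ρ h0 h1 θ hθ => hull_subset_tile_zero ?_
  exact h ρ h0 h1 θ ⟨by linarith [hθ.1], by linarith [hθ.2]⟩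

/-- The reflex angle runs from -π/2 to 11π/14. No single triangle contains it, so it is cut along
the direction 5π/14 of `hept 1`. -/
lemma tile_hasSector_three : HasSector tile (refl 3) (cis (π / 7)) (π - 5 * π / 14) := by
  have hc : 0 < edge * (2 * Real.cos (3 * π / 7)) := mul_pos edge_pos (mul_pos two_pos
    (Real.cos_pos_of_mem_Ioo ⟨by linarith [pi_pos], by linarith [pi_pos]⟩))
  obtain ⟨r, hr, h⟩ := sector_subset_triangle (refl 3) (a := -(π / 2)) (b := 5 * π / 14)
    (by linarith [pi_pos]) (by linarith [pi_pos]) edge_pos hc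
  obtain ⟨r', hr', h'⟩ := sector_subset_triangle (refl 3) (a := 5 * π / 14) (b := 11 * π / 14)
    (by linarith [pi_pos]) (by linarith [pi_pos]) hc edge_pos
  rw [← hept_one_eq', ← refl_neg_three_eq] at h
  rw [← hept_one_eq', ← hept_two_eq] at h'
  refine hasSector_of_angles (lt_min hr hr') (by linarith [pi_pos]) fun ρ h0 h1 θ hθ => ?_
  rcases le_total θ (5 * π / 14) with hle | hle
  · exact hull_subset_tile_three
      (h ρ h0 (h1.trans_le (min_le_left _ _)) θ ⟨by linarith [hθ.1], hle⟩)
  · exact hull_subset_tile_two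
      (h' ρ h0 (h1.trans_le (min_le_right _ _)) θ ⟨hle, by linarith [hθ.2]⟩)

/-- The two triangles cut off the notch by its short diagonals overlap. -/
lemma interior_notch_triangles : (interior (convexHull ℝ {refl 3, refl (-3), hept 2} ∩
    convexHull ℝ {refl (-3), refl 3, hept (-2)})).Nonempty := by
  have hc : 0 < edge * (2 * Real.cos (π / 7)) := mul_pos edge_pos (mul_pos two_pos
    (Real.cos_pos_of_mem_Ioo ⟨by linarith [pi_pos], by linarith [pi_pos]⟩))
  obtain ⟨r, hr, h⟩ := sector_subset_triangle (refl 3) (a := -(17 * π / 14)) (b := -(π / 2))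
    (by linarith [pi_pos]) (by linarith [pi_pos]) edge_pos edge_pos
  obtain ⟨r', hr', h'⟩ := sector_subset_triangle (refl 3) (a := -(9 * π / 14)) (b := -(π / 2))
    (by linarith [pi_pos]) (by linarith [pi_pos]) hc edge_pos
  have e : cis (-(17 * π / 14)) = cis (11 * π / 14) := by
    rw [← cis_add_two_pi]; congr 1; ring
  rw [← refl_neg_three_eq, e, ← hept_two_eq] at h
  rw [← refl_neg_three_eq, ← hept_neg_two_eq] at h'
  have e1 : ({refl 3, hept 2, refl (-3)} : Set ℂ) = {refl 3, refl (-3), hept 2} := by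
    ext x; simp only [mem_insert_iff, mem_singleton_iff]; tauto
  have e2 : ({refl 3, hept (-2), refl (-3)} : Set ℂ) = {refl (-3), refl 3, hept (-2)} := by
    ext x; simp only [mem_insert_iff, mem_singleton_iff]; tauto
  rw [e1] at h; rw [e2] at h'
  -- Seen from `refl 3`, the triangles span the angles [-17π/14, -π/2] and [-9π/14, -π/2]; the
  -- second range, with axis -8π/14, is common.
  have hs : HasSector (convexHull ℝ {refl 3, refl (-3), hept 2} ∩
      convexHull ℝ {refl (-3), refl 3, hept (-2)}) (refl 3) (cis (-(8 * π / 14))) (π / 14) := by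
    refine hasSector_of_angles (lt_min hr hr') (by positivity) fun ρ h0 h1 θ hθ => ⟨?_, ?_⟩
    · exact h ρ h0 (h1.trans_le (min_le_left _ _)) θ
        ⟨by linarith [hθ.1, pi_pos], by linarith [hθ.2]⟩
    · exact h' ρ h0 (h1.trans_le (min_le_right _ _)) θ
        ⟨by linarith [hθ.1], by linarith [hθ.2]⟩
  have hz : Real.cos (π / 14) * ‖cis (-(8 * π / 14))‖ <
      (cis (-(8 * π / 14)) * conj (cis (-(8 * π / 14)))).re := by
    have hlt : Real.cos (π / 14) < 1 := by
      rw [← Real.cos_zero]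
      exact Real.cos_lt_cos_of_nonneg_of_le_pi le_rfl (by linarith [pi_pos]) (by positivity)
    rw [Complex.mul_conj, Complex.normSq_eq_norm_sq, norm_cis]; simpa using hlt
  simpa using hs.interior_inter hs hz hz

/-! ### Images of the tile under isometries, and tiles meeting at ports. -/

/-- Isometries of the plane in complex coordinates. -/
lemma exists_isometry_eq (g : ℂ ≃ᵢ ℂ) : ∃ c : ℂ, ‖c‖ = 1 ∧
    ((∀ z, g z = g 0 + c * z) ∨ ∀ z, g z = g 0 + c * conj z) := by
  obtain ⟨c, hc⟩ := linear_isometry_complex g.toRealLinearIsometryEquiv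
  refine ⟨c, Circle.norm_coe c, ?_⟩
  have h : ∀ z, g z = g 0 + g.toRealLinearIsometryEquiv z := fun z => by
    rw [IsometryEquiv.toRealLinearIsometryEquiv_apply]; ring
  rcases hc with hc | hc
  · left; intro z; rw [h, hc]; simp [rotation_apply]
  · right; intro z; rw [h, hc]; simp [rotation_apply]

lemma HasSector.image {A : Set ℂ} {p e : ℂ} {β : ℝ} (h : HasSector A p e β) (he : ‖e‖ = 1)
    (g : ℂ ≃ᵢ ℂ) : ∃ e', ‖e'‖ = 1 ∧ HasSector (g '' A) (g p) e' β := by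
  obtain ⟨r, hr, H⟩ := h
  obtain ⟨c, hc, hg | hg⟩ := exists_isometry_eq g
  · refine ⟨c * e, by simp [hc, he], r, hr, fun z hz hz' => ⟨p + conj c * z, H _ ?_ ?_, ?_⟩⟩
    · simpa [hc] using hz
    · rw [norm_mul, RCLike.norm_conj, hc, one_mul]
      convert hz' using 2; rw [map_mul]; ring
    · rw [hg, hg p]
      have : c * conj c = 1 := by rw [Complex.mul_conj, Complex.normSq_eq_norm_sq, hc]; simp
      linear_combination z * this
  · refine ⟨c * conj e, by simp [hc, he], r, hr,
      fun z hz hz' => ⟨p + c * conj z, H _ ?_ ?_, ?_⟩⟩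
    · simpa [hc] using hz
    · rw [norm_mul, RCLike.norm_conj, hc, one_mul]
      convert hz' using 1
      rw [← Complex.conj_re]; congr 1; simp only [map_mul, Complex.conj_conj]; ring
    · rw [hg, hg p]
      have : c * conj c = 1 := by rw [Complex.mul_conj, Complex.normSq_eq_norm_sq, hc]; simp
      simp only [map_add, map_mul, Complex.conj_conj]
      linear_combination z * this

/-- The arc ends of the tile and of its mirror image. -/
def ports : Set ℂ := {hept 0, refl 3, refl (-3)}

lemma arcEnds_subset_ports : arcEnds ⊆ ports := by
  intro x; simp only [arcEnds, ports, mem_insert_iff, mem_singleton_iff]; tauto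

lemma image_conj_ports : conj '' ports = ports := by
  simp only [ports, image_insert_eq, image_singleton, ← hept_neg, ← refl_neg, neg_neg, neg_zero]
  ext x; simp only [mem_insert_iff, mem_singleton_iff]; tauto

/-- On a set symmetric under conjugation a flip acts like a direct isometry, so only the latter need
be studied for the tile and its ports. -/
lemma image_eq_of_symm {s : Set ℂ} (hs : conj '' s = s) {g : ℂ ≃ᵢ ℂ} {b c : ℂ}
    (h : (∀ z, g z = b + c * z) ∨ ∀ z, g z = b + c * conj z) :
    g '' s = (fun z => b + c * z) '' s := by
  rcases h with h | h
  · exact image_congr fun z _ => h z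
  · conv_rhs => rw [← hs, image_image]
    exact image_congr fun z _ => h z

lemma exists_tile_image_eq (g : ℂ ≃ᵢ ℂ) : ∃ c : ℂ, ‖c‖ = 1 ∧
    (∀ s : Set ℂ, conj '' s = s → g '' s = (fun z => g 0 + c * z) '' s) ∧ g 1 = g 0 + c := by
  obtain ⟨c, hc, h⟩ := exists_isometry_eq g
  exact ⟨c, hc, fun s hs => image_eq_of_symm hs h, by rcases h with h | h <;> simp [h 1]⟩

lemma cos_four_pi_div : -(1 / 2) < Real.cos (4 * π / 7) ∧ Real.cos (4 * π / 7) < 0 := by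
  constructor
  · rw [← Real.cos_pi_div_three, ← Real.cos_pi_sub]
    exact Real.cos_lt_cos_of_nonneg_of_le_pi (by positivity) (by linarith [pi_pos])
      (by linarith [pi_pos])
  · exact Real.cos_neg_of_pi_div_two_lt_of_lt (by linarith [pi_pos]) (by linarith [pi_pos])

lemma cos_six_pi_div : Real.cos (6 * π / 7) < Real.cos (4 * π / 7) :=
  Real.cos_lt_cos_of_nonneg_of_le_pi (by positivity) (by linarith [pi_pos])
    (by linarith [pi_pos])

lemma refl_three_re : (refl 3).re = 2 * Real.cos (4 * π / 7) - Real.cos (6 * π / 7) := by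
  have e : (2 * π * (3 : ℤ) / 7 : ℝ) = 6 * π / 7 := by push_cast; ring
  rw [refl_eq, Complex.sub_re, Complex.ofReal_re, cis_re, Real.cos_neg, e]

lemma refl_three_ne : refl 3 ≠ hept 0 ∧ refl (-3) ≠ hept 0 := by
  have h : refl 3 ≠ hept 0 := by
    intro h
    have h1 := congrArg Complex.re h
    rw [refl_three_re, hept_zero, Complex.one_re] at h1
    linarith [cos_four_pi_div.2, Real.neg_one_le_cos (6 * π / 7)]
  refine ⟨h, fun h' => h ?_⟩
  have := congrArg conj h'
  rwa [← refl_neg, ← hept_neg, neg_neg, neg_zero] at this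

lemma image_tile_hasSector (g : ℂ ≃ᵢ ℂ) {p : ℂ} (hp : p ∈ ports) :
    (p = hept 0 ∧ ∃ e, ‖e‖ = 1 ∧ HasSector (g '' tile) (g p) e (5 * π / 14)) ∨
    ((p = refl 3 ∨ p = refl (-3)) ∧
      ∃ e, ‖e‖ = 1 ∧ HasSector (g '' tile) (g p) e (π - 5 * π / 14)) := by
  rcases hp with rfl | rfl | rfl
  · exact Or.inl ⟨rfl, tile_hasSector_zero.image (norm_cis _) g⟩
  · exact Or.inr ⟨Or.inl rfl, tile_hasSector_three.image (norm_cis _) g⟩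
  · refine Or.inr ⟨Or.inr rfl, ?_⟩
    -- The corner `refl (-3)` is reduced to `refl 3` by flipping the tile first.
    have h := tile_hasSector_three.image (norm_cis _) (Complex.conjLIE.toIsometryEquiv.trans g)
    have e1 : (Complex.conjLIE.toIsometryEquiv.trans g) '' tile = g '' tile := by
      conv_rhs => rw [← image_conj_tile, image_image]
      rfl
    have e2 : (Complex.conjLIE.toIsometryEquiv.trans g) (refl 3) = g (refl (-3)) := by
      rw [refl_neg]; rfl
    rwa [e1, e2] at h

lemma cos_five_pi_div : 0 < Real.cos (5 * π / 14) ∧ Real.cos (5 * π / 14) < 1 / 2 := by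
  constructor
  · exact Real.cos_pos_of_mem_Ioo ⟨by linarith [pi_pos], by linarith [pi_pos]⟩
  · rw [← Real.cos_pi_div_three]
    exact Real.cos_lt_cos_of_nonneg_of_le_pi (by positivity) (by linarith [pi_pos])
      (by linarith [pi_pos])

lemma image_tile_hasSector' (g : ℂ ≃ᵢ ℂ) {p : ℂ} (hp : p ∈ g '' ports) :
    ∃ e, ‖e‖ = 1 ∧ HasSector (g '' tile) p e (5 * π / 14) := by
  obtain ⟨q, hq, rfl⟩ := hp
  rcases image_tile_hasSector g hq with ⟨-, h⟩ | ⟨-, e, he, h⟩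
  · exact h
  · refine ⟨e, he, h.mono subset_rfl ?_⟩
    rw [Real.cos_pi_sub]; linarith [cos_five_pi_div.1]

lemma ports_two_of_three {g : Fin 3 → ℂ ≃ᵢ ℂ} {p : ℂ} (h : ∀ i, p ∈ g i '' ports) :
    ∃ i j, i ≠ j ∧ (interior (g i '' tile ∩ g j '' tile)).Nonempty := by
  choose e he hs using fun i => image_tile_hasSector' (g i) (h i)
  exact HasSector.two_of_three cos_five_pi_div.2 he hs

/-- A tile whose corner `hept 0` sits at a concave corner of the prototile fills this corner. -/
lemma triangle_subset_of_corner {h : ℂ ≃ᵢ ℂ} (h1 : h (hept 0) = refl 3)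
    (hT : interior (tile ∩ h '' tile) = ∅) :
    convexHull ℝ {refl 3, refl (-3), hept 2} ⊆ h '' tile := by
  obtain ⟨c, hc, him, hb⟩ := exists_tile_image_eq h
  rw [hept_zero] at h1
  rw [him tile image_conj_tile] at hT ⊢
  -- The axis of the tile at `hept 0` is `cis π` = -1, and the rotation by `c` turns it to `-c`.
  have hs : HasSector ((fun z => h 0 + c * z) '' tile) (refl 3) (-c) (5 * π / 14) := by
    obtain ⟨r, hr, H⟩ := tile_hasSector_zero
    refine ⟨r, hr, fun z hz hz' => ⟨_, H (conj c * z) (by simpa [hc] using hz) ?_, ?_⟩⟩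
    · rw [norm_mul, RCLike.norm_conj, hc, one_mul]
      convert hz' using 2
      have : cis π = -1 := by apply Complex.ext <;> simp
      rw [this]; simp; ring
    · have : c * conj c = 1 := by rw [Complex.mul_conj, Complex.normSq_eq_norm_sq, hc]; simp
      rw [← h1, hb, hept_zero]
      linear_combination z * this
  -- The two half-angles add up to π, so the axes are opposite; this determines `c` and sends `hept
  -- 1`, `hept (-1)` to `hept 2`, `refl (-3)`.
  have hopp := tile_hasSector_three.eq_neg_of_disjoint (by positivity) (by linarith [pi_pos])
    (norm_cis _) (by simpa using hc) hs hT
  have hc' : c = cis (π / 7) := by linear_combination -hopp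
  have himage : ∀ z, h 0 + c * z = refl 3 + c * (z - 1) := fun z => by
    rw [← h1, hb]; ring
  let f : ℂ →ᵃ[ℝ] ℂ := (LinearMap.mulLeft ℝ c).toAffineMap + AffineMap.const ℝ ℂ (h 0)
  have hf : (fun z => h 0 + c * z) = f := by
    funext z; simp [f]; ring
  refine Subset.trans ?_ (image_mono hull_subset_tile_zero)
  rw [hf, AffineMap.image_convexHull, ← hf]
  refine convexHull_mono ?_
  have e1 : refl 3 + c * (hept 1 - 1) = hept 2 := by
    have := hept_one_eq; rw [hept_zero] at this
    rw [this, hc', hept_two_eq, add_sub_cancel_left, mul_left_comm, ← cis_add]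
    congr 3; ring
  have e2 : refl 3 + c * (hept (-1) - 1) = refl (-3) := by
    have := hept_neg_one_eq; rw [hept_zero] at this
    rw [this, hc', refl_neg_three_eq, add_sub_cancel_left, mul_left_comm, ← cis_add,
      ← cis_sub_two_pi]
    congr 3; ring
  simp only [image_insert_eq, image_singleton, himage, e1, e2]
  rw [hept_zero]
  intro x; simp only [mem_insert_iff, mem_singleton_iff, sub_self, mul_zero, add_zero]; tauto

lemma interior_image (g : ℂ ≃ᵢ ℂ) (s : Set ℂ) : interior (g '' s) = g '' interior s :=
  (g.toHomeomorph.image_interior s).symm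

lemma image_trans_symm (t u : ℂ ≃ᵢ ℂ) (s : Set ℂ) : t '' ((u.trans t.symm) '' s) = u '' s := by
  rw [image_image]; exact image_congr fun z _ => by simp

lemma interior_inter_trans_symm (t u u' : ℂ ≃ᵢ ℂ) (s : Set ℂ) :
    interior (u '' s ∩ u' '' s) =
      t '' interior ((u.trans t.symm) '' s ∩ (u'.trans t.symm) '' s) := by
  rw [← interior_image, image_inter t.injective, image_trans_symm, image_trans_symm]

/-- Two reflex corners at one point overlap, so the port of `u` there can only be the convex one. -/
lemma corner_of_port {t u : ℂ ≃ᵢ ℂ} {w : ℂ} (hw : w = refl 3 ∨ w = refl (-3))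
    (hw0 : t w ∈ u '' ports) (hn : interior (t '' tile ∩ u '' tile) = ∅) : u (hept 0) = t w := by
  obtain ⟨q, hq, hqw⟩ := hw0
  rcases image_tile_hasSector u hq with ⟨rfl, -⟩ | ⟨-, e, he, hs⟩
  · exact hqw
  · exfalso
    have hws : ∃ e, ‖e‖ = 1 ∧ HasSector (t '' tile) (t w) e (π - 5 * π / 14) := by
      have hwp : w ∈ ports := by
        simp only [ports, mem_insert_iff, mem_singleton_iff]; tauto
      rcases image_tile_hasSector t hwp with ⟨h, -⟩ | ⟨-, h⟩
      · have := refl_three_ne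
        rcases hw with rfl | rfl <;> tauto
      · exact h
    obtain ⟨e', he', hs'⟩ := hws
    rw [hqw] at hs
    refine (hs'.overlap_of_reflex ?_ he' he hs).ne_empty hn
    rw [Real.cos_pi_sub]; linarith [cos_five_pi_div.1]

lemma triangle_subset_of_port {t u : ℂ ≃ᵢ ℂ} (hp : t (refl 3) ∈ u '' ports)
    (hn : interior (t '' tile ∩ u '' tile) = ∅) :
    convexHull ℝ {refl 3, refl (-3), hept 2} ⊆ (u.trans t.symm) '' tile := by
  have h0 := corner_of_port (Or.inl rfl) hp hn
  refine triangle_subset_of_corner (by simp [h0]) ?_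
  have e : (t.trans t.symm) '' tile = tile := by
    rw [image_congr (g := id) fun z _ => by simp, image_id]
  rwa [interior_inter_trans_symm t, image_eq_empty, e] at hn

lemma triangle_subset_of_port' {t u : ℂ ≃ᵢ ℂ} (hp : t (refl (-3)) ∈ u '' ports)
    (hn : interior (t '' tile ∩ u '' tile) = ∅) :
    convexHull ℝ {refl (-3), refl 3, hept (-2)} ⊆ (u.trans t.symm) '' tile := by
  set k := Complex.conjLIE.toIsometryEquiv
  have hk : ∀ s, (k.trans t) '' s = t '' (conj '' s) := fun s => by
    rw [image_image]; rfl
  have h1 : (k.trans t) (refl 3) = t (refl (-3)) := by rw [refl_neg]; rfl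
  have h := triangle_subset_of_port (t := k.trans t) (u := u) (by rwa [h1])
    (by rwa [hk, image_conj_tile])
  have h2 := image_mono (f := conj) h
  rw [image_conj_convexHull, image_image] at h2
  simp only [image_insert_eq, image_singleton, ← hept_neg, ← refl_neg, neg_neg] at h2
  refine h2.trans (subset_of_eq (image_congr fun z _ => ?_))
  exact Complex.conj_conj _

/-- At most one tile has an arc end in the notch of a given tile. -/
lemma notch_overlap {t u u' : ℂ ≃ᵢ ℂ} (hp : t (refl 3) ∈ u '' ports)
    (hp' : t (refl (-3)) ∈ u' '' ports) (hn : interior (t '' tile ∩ u '' tile) = ∅)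
    (hn' : interior (t '' tile ∩ u' '' tile) = ∅) :
    (interior (u '' tile ∩ u' '' tile)).Nonempty := by
  rw [interior_inter_trans_symm t]
  exact (interior_notch_triangles.mono (interior_mono (inter_subset_inter
    (triangle_subset_of_port hp hn) (triangle_subset_of_port' hp' hn')))).image _

/-! ### Enclosing disc and half-plane of the tile, and its symmetries. -/

lemma refl_three_re_ge : Real.cos (4 * π / 7) ≤ (refl 3).re := by
  rw [refl_three_re]
  have h : Real.cos (6 * π / 7) < -(1/2) := by
    rw [← Real.cos_pi_div_three, ← Real.cos_pi_sub]
    exact Real.cos_lt_cos_of_nonneg_of_le_pi (by linarith [pi_pos]) (by linarith [pi_pos])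
      (by linarith [pi_pos])
  linarith [cos_four_pi_div.1]

/-- With κ = cos (4π/7), the squared norm is 1 + 4κ(κ - cos (6π/7)), where κ is negative and the
bracket positive. -/
lemma norm_refl_three_le : ‖refl 3‖ ≤ 1 := by
  have e : (2 * π * (3 : ℤ) / 7 : ℝ) = 6 * π / 7 := by push_cast; ring
  have him : (refl 3).im = Real.sin (6 * π / 7) := by
    rw [refl_eq, Complex.sub_im, Complex.ofReal_im, cis_im, Real.sin_neg, e]; ring
  have h : ‖refl 3‖ ^ 2 ≤ 1 := by
    rw [Complex.sq_norm, Complex.normSq_apply, refl_three_re, him]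
    nlinarith [cos_four_pi_div.2, cos_six_pi_div, Real.sin_sq_add_cos_sq (6 * π / 7)]
  nlinarith [norm_nonneg (refl 3)]

lemma hept_two_re : (hept 2).re = Real.cos (4 * π / 7) := by
  have e : (2 * π * (2 : ℤ) / 7 : ℝ) = 4 * π / 7 := by push_cast; ring
  rw [hept_eq, cis_re, e]

lemma tile_subset_of_convex {S : Set ℂ} (hS : Convex ℝ S) (h0 : hept 0 ∈ S) (h1 : hept 1 ∈ S)
    (h1' : hept (-1) ∈ S) (h2 : hept 2 ∈ S) (h2' : hept (-2) ∈ S) (h3 : refl 3 ∈ S)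
    (h3' : refl (-3) ∈ S) : tile ⊆ S := by
  refine union_subset (union_subset ?_ ?_) ?_ <;> refine convexHull_min ?_ hS <;> intro x <;>
    simp only [mem_insert_iff, mem_singleton_iff] <;> rintro (rfl | h)
  all_goals first | assumption | skip
  all_goals rcases h with rfl | h
  all_goals first | assumption | (subst h; assumption) | skip
  all_goals rcases h with rfl | rfl | rfl <;> assumption

lemma tile_subset_closedBall : tile ⊆ Metric.closedBall 0 1 := by
  have hh : ∀ k, hept k ∈ Metric.closedBall (0 : ℂ) 1 := fun k => by simp [hept_eq]
  refine tile_subset_of_convex (convex_closedBall _ _) (hh _) (hh _) (hh _) (hh _) (hh _) ?_ ?_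
  · simpa using norm_refl_three_le
  · simpa [refl_neg] using norm_refl_three_le

lemma tile_subset_halfPlane : tile ⊆ {z | Real.cos (4 * π / 7) ≤ z.re} := by
  have h1 : Real.cos (4 * π / 7) ≤ (hept 1).re := by
    rw [hept_eq, cis_re]
    refine Real.cos_le_cos_of_nonneg_of_le_pi ?_ ?_ ?_ <;> push_cast <;> linarith [pi_pos]
  have h0 : Real.cos (4 * π / 7) ≤ (hept 0).re := by
    rw [hept_zero]; exact Real.cos_le_one _
  refine tile_subset_of_convex (convex_halfSpace_ge Complex.reLm.isLinear _) h0 h1 ?_ ?_ ?_ ?_ ?_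
  · rw [mem_ofPred, hept_neg, Complex.conj_re]; exact h1
  · exact hept_two_re.ge
  · rw [mem_ofPred, hept_neg, Complex.conj_re]; exact hept_two_re.ge
  · exact refl_three_re_ge
  · rw [mem_ofPred, refl_neg, Complex.conj_re]; exact refl_three_re_ge

lemma hept_mem_tile : hept 0 ∈ tile ∧ hept 2 ∈ tile ∧ hept (-2) ∈ tile := by
  refine ⟨hull_subset_tile_zero (subset_convexHull ℝ _ (by simp)),
    hull_subset_tile_two (subset_convexHull ℝ _ (by simp)),
    Or.inr (subset_convexHull ℝ _ (by simp))⟩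

/-- The tile has no symmetries besides the reflection in its axis. -/
lemma symmetry_of_tile {h : ℂ ≃ᵢ ℂ} (hT : h '' tile = tile) :
    h 0 = 0 ∧ h '' ports = ports := by
  obtain ⟨c, hc, him, -⟩ := exists_tile_image_eq h
  rw [him tile image_conj_tile] at hT
  rw [him ports image_conj_ports]
  set κ := Real.cos (4 * π / 7)
  set s := (hept 2).im with hs
  have hκ := cos_four_pi_div
  have hs1 : κ ^ 2 + s ^ 2 = 1 := by
    have : ‖hept 2‖ ^ 2 = 1 := by rw [hept_eq, norm_cis]; norm_num
    rw [Complex.sq_norm, Complex.normSq_apply, hept_two_re] at this; linarith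
  have hre : (hept (-2)).re = κ := by rw [hept_neg, Complex.conj_re, hept_two_re]
  have him2 : (hept (-2)).im = -s := by rw [hept_neg, Complex.conj_im]
  have hc2 : c.re ^ 2 + c.im ^ 2 = 1 := by
    have := Complex.sq_norm c; rw [hc, Complex.normSq_apply] at this; linarith
  have hq : h 0 = 0 := by
    set q := h 0
    -- The tile also lies in the unit disc about `q`. Points of norm 1 in that disc satisfy this
    -- inequality, and `hept 0`, `hept 2`, `hept (-2)` together leave only `q = 0`.
    have key : ∀ w ∈ tile, ‖w‖ = 1 → ‖q‖ ^ 2 ≤ 2 * (q.re * w.re + q.im * w.im) := by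
      intro w hw hw1
      rw [← hT] at hw
      obtain ⟨z, hz, rfl⟩ := hw
      have hz1 : ‖z‖ ≤ 1 := by simpa using tile_subset_closedBall hz
      have h1 : ‖c * z‖ ^ 2 ≤ 1 := by
        rw [norm_mul, hc, one_mul]; nlinarith [norm_nonneg z]
      have h2 : ‖q + c * z‖ ^ 2 = 1 := by simp only [] at hw1; rw [hw1]; norm_num
      have h3 : c * z = (q + c * z) - q := by ring
      rw [h3, Complex.sq_norm, Complex.normSq_apply, Complex.sub_re, Complex.sub_im] at h1
      rw [Complex.sq_norm, Complex.normSq_apply] at h2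
      rw [Complex.sq_norm, Complex.normSq_apply]
      nlinarith
    have k0 := key _ hept_mem_tile.1 (by simp [hept_zero])
    have k1 := key _ hept_mem_tile.2.1 (by simp [hept_eq])
    have k2 := key _ hept_mem_tile.2.2 (by simp [hept_eq])
    rw [hept_zero, Complex.one_re, Complex.one_im] at k0
    rw [hept_two_re] at k1
    rw [hre, him2] at k2
    have hn := sq_nonneg ‖q‖
    have : q.re = 0 := by
      apply le_antisymm
      · by_contra hcon
        push Not at hcon
        nlinarith [mul_neg_of_pos_of_neg hcon hκ.2]
      · nlinarith
    rw [this] at k0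
    have : ‖q‖ ^ 2 = 0 := by linarith
    simpa using this
  refine ⟨hq, ?_⟩
  rw [hq] at hT ⊢
  -- Rotation must keep the tile in its half-plane. If c ≠ 1, the points `hept (±2)` give 1 + Re c ≤
  -- 2κ² and `hept 0` gives κ ≤ Re c, which contradict -1/2 < κ < 0.
  have key : ∀ w ∈ tile, κ ≤ c.re * w.re - c.im * w.im := by
    intro w hw
    have h1 : 0 + c * w ∈ tile := hT ▸ mem_image_of_mem (fun z => 0 + c * z) hw
    have := tile_subset_halfPlane h1
    simpa using this
  have k0 := key _ hept_mem_tile.1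
  have k1 := key _ hept_mem_tile.2.1
  have k2 := key _ hept_mem_tile.2.2
  rw [hept_zero, Complex.one_re, Complex.one_im] at k0
  rw [hept_two_re] at k1
  rw [hre, him2] at k2
  have hc1 : c.re = 1 := by
    by_contra hne
    have hlt : c.re < 1 := lt_of_le_of_ne (by nlinarith [sq_nonneg c.im]) hne
    have h1 : (c.im * s) ^ 2 ≤ (-κ * (1 - c.re)) ^ 2 := by
      apply sq_le_sq'
      · change κ ≤ c.re * κ - _ at k1
        linarith
      · change κ ≤ c.re * κ - _ at k1
        linarith
    have h2 : (1 - c.re) * ((1 + c.re) * s ^ 2) ≤ (1 - c.re) * (κ ^ 2 * (1 - c.re)) := by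
      have : c.im ^ 2 = (1 - c.re) * (1 + c.re) := by linarith
      nlinarith
    have h3 := le_of_mul_le_mul_left h2 (by linarith)
    have h4 : 1 + c.re ≤ 2 * κ ^ 2 := by nlinarith
    nlinarith
  have hci : c.im = 0 := by
    rw [hc1] at hc2; nlinarith
  have : c = 1 := Complex.ext hc1 hci
  simp [this]

end
end HeptagonTiling

/-! ### Infinite connected graphs with at most two neighbours per vertex. -/

namespace HeptagonTiling
noncomputable section

/-- Every vertex of the graph has at most two neighbours. -/
def AtMostTwo {V : Type*} (G : SimpleGraph V) : Prop :=
  ∀ v a b c, G.Adj v a → G.Adj v b → G.Adj v c → a = b ∨ a = c ∨ b = c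

lemma eq_univ_of_adj_closed {V : Type*} {G : SimpleGraph V} (hG : G.Connected) {S : Set V}
    (hne : S.Nonempty) (h : ∀ x ∈ S, ∀ y, G.Adj x y → y ∈ S) (v : V) : v ∈ S := by
  obtain ⟨x, hx⟩ := hne
  obtain ⟨p⟩ := hG.preconnected x v
  induction p with
  | nil => exact hx
  | cons hadj _ ih => exact ih (h _ hx _ hadj)

lemma exists_walk_getVert {V : Type*} {G : SimpleGraph V} {u v : V} (p : G.Walk u v) {i j : ℕ}
    (hij : i ≤ j) (hj : j ≤ p.length) :
    ∃ q : G.Walk (p.getVert i) (p.getVert j), q.length = j - i := by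
  refine ⟨((p.drop i).take (j - i)).copy rfl ?_, ?_⟩
  · rw [SimpleGraph.Walk.drop_getVert]; congr 1; omega
  · rw [SimpleGraph.Walk.length_copy, SimpleGraph.Walk.take_length, SimpleGraph.Walk.drop_length]
    omega

/-- An automorphism of a path-like graph that is not a reflection has finitely many orbits. -/
lemma exists_finite_orbits {V : Type*} {G : SimpleGraph V} (hG : G.Connected) (h2 : AtMostTwo G)
    (σ : Equiv.Perm V) (hσ : ∀ x y, G.Adj (σ x) (σ y) ↔ G.Adj x y) (hfix : ∀ x, σ x ≠ x)
    (hfix2 : ∀ x, σ (σ x) ≠ x) :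
    ∃ F : Set V, F.Finite ∧ ∀ v, ∃ f ∈ F, ∃ m : ℤ, v = (σ ^ m) f := by
  classical
  have hσ' : ∀ (m : ℤ) x y, G.Adj ((σ ^ m) x) ((σ ^ m) y) ↔ G.Adj x y := by
    intro m
    induction m using Int.induction_on with
    | zero => simp
    | succ i ih => intro x y; rw [zpow_add_one, Equiv.Perm.mul_apply, Equiv.Perm.mul_apply, ih, hσ]
    | pred i ih =>
      intro x y
      rw [zpow_sub_one, Equiv.Perm.mul_apply, Equiv.Perm.mul_apply, ih, ← hσ]
      simp
  -- A shortest walk from any vertex to its own image is a path and serves as a fundamental domain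
  -- for σ.
  have hex : ∃ n, ∃ t, ∃ p : G.Walk t (σ t), p.length = n := by
    obtain ⟨t⟩ := hG.nonempty
    obtain ⟨p⟩ := hG.preconnected t (σ t)
    exact ⟨_, t, p, rfl⟩
  obtain ⟨t, p, hp⟩ := Nat.find_spec hex
  have hmin : ∀ t' (q : G.Walk t' (σ t')), p.length ≤ q.length := fun t' q =>
    hp ▸ Nat.find_min' hex ⟨t', q, rfl⟩
  have hpath : p.IsPath := by
    apply p.isPath_of_length_eq_dist
    refine le_antisymm ?_ (SimpleGraph.dist_le p)
    obtain ⟨q, hq⟩ := hG.exists_walk_length_eq_dist t (σ t)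
    exact hq ▸ hmin t q
  have hinj := hpath.getVert_injOn
  set k := p.length with hk
  have h0 : p.getVert 0 = t := p.getVert_zero
  have hkk : p.getVert k = σ t := p.getVert_length
  have hk0 : 0 < k := by
    rcases Nat.eq_zero_or_pos k with h | h
    · rw [h, h0] at hkk; exact absurd hkk.symm (hfix t)
    · exact h
  have hadj : ∀ i < k, G.Adj (p.getVert i) (p.getVert (i + 1)) := fun i hi =>
    p.adj_getVert_succ hi
  have hback : G.Adj t (σ.symm (p.getVert (k - 1))) := by
    rw [← hσ, Equiv.apply_symm_apply]
    have := hadj (k - 1) (by omega)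
    rw [Nat.sub_add_cancel hk0, hkk] at this
    exact this.symm
  -- Otherwise σ² fixes `t` (length 1), or dropping both end edges leaves a shorter walk from a
  -- vertex to its image. Hence these are all the neighbours of `t`, and the σ-translates of the
  -- path are closed under adjacency.
  have hne : p.getVert 1 ≠ σ.symm (p.getVert (k - 1)) := by
    intro h
    rw [Equiv.eq_symm_apply] at h
    rcases Nat.lt_or_ge k 2 with hlt | hge
    · have hk1 : k = 1 := by omega
      rw [hk1] at hkk
      rw [hk1, hkk, Nat.sub_self, h0] at h
      exact hfix2 t h
    · obtain ⟨q, hq⟩ := exists_walk_getVert p (i := 1) (j := k - 1) (by omega) (by omega)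
      have := hmin _ (q.copy rfl h.symm)
      rw [SimpleGraph.Walk.length_copy, hq] at this
      omega
  refine ⟨p.getVert '' Iio k, (finite_Iio k).image _, ?_⟩
  have hcl : ∀ r < k, ∀ y, G.Adj (p.getVert r) y →
      ∃ f ∈ p.getVert '' Iio k, ∃ m : ℤ, y = (σ ^ m) f := by
    have hin : ∀ r ≤ k, ∃ f ∈ p.getVert '' Iio k, ∃ m : ℤ, p.getVert r = (σ ^ m) f := by
      intro r hr
      rcases hr.lt_or_eq with h | h
      · exact ⟨_, mem_image_of_mem _ h, 0, by simp⟩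
      · exact ⟨_, mem_image_of_mem _ hk0, 1, by rw [h, h0, hkk]; simp⟩
    intro r hr y hy
    rcases Nat.eq_zero_or_pos r with rfl | hr0
    · rw [h0] at hy
      have h1 := hadj 0 hk0
      rw [h0, zero_add] at h1
      rcases h2 t _ _ _ h1 hback hy with h | h | h
      · exact absurd h hne
      · exact h ▸ hin 1 hk0
      · exact ⟨_, mem_image_of_mem _ (show k - 1 < k by omega), -1, by rw [← h]; simp⟩
    · have h1 := hadj r hr
      have h3 := hadj (r - 1) (by omega)
      rw [Nat.sub_add_cancel hr0] at h3
      rcases h2 _ _ _ _ h3.symm h1 hy with h | h | h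
      · have := hinj (show r - 1 ≤ p.length by omega) (show r + 1 ≤ p.length by omega) h
        omega
      · exact h ▸ hin (r - 1) (by omega)
      · exact h ▸ hin (r + 1) (by omega)
  refine eq_univ_of_adj_closed hG (S := {v | ∃ f ∈ p.getVert '' Iio k, ∃ m : ℤ, v = (σ ^ m) f})
    ⟨t, t, ⟨0, hk0, h0⟩, 0, by simp⟩ ?_
  rintro x ⟨_, ⟨r, hr, rfl⟩, m, rfl⟩ y hy
  have hy' : G.Adj (p.getVert r) ((σ ^ (-m)) y) := by
    rw [← hσ' m, ← Equiv.Perm.mul_apply, ← zpow_add]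
    simpa using hy
  obtain ⟨f, hf, n, hn⟩ := hcl r hr _ hy'
  refine ⟨f, hf, m + n, ?_⟩
  rw [zpow_add, Equiv.Perm.mul_apply, ← hn, ← Equiv.Perm.mul_apply, ← zpow_add]
  simp

/-- An infinite connected graph with at most two neighbours of each vertex and at most one neighbour
of some vertex is a one-way infinite path. -/
lemma exists_ray {V : Type*} [Infinite V] {G : SimpleGraph V} (hG : G.Connected)
    (h2 : AtMostTwo G) {v : V} (hv : ∀ a b, G.Adj v a → G.Adj v b → a = b) :
    ∃ f : ℕ → V, f.Bijective ∧ ∀ n, G.Adj (f n) (f (n + 1)) := by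
  have hpred : ∀ n w, G.dist v w = n + 1 → ∃ u, G.dist v u = n ∧ G.Adj u w := by
    intro n w hw
    obtain ⟨p, hp⟩ := hG.exists_walk_length_eq_dist w v
    rw [SimpleGraph.dist_comm, hw] at hp
    cases p with
    | nil => simp at hp
    | cons h q =>
      rename_i u
      refine ⟨u, ?_, h.symm⟩
      have h1 : G.dist u v ≤ n := by
        refine (SimpleGraph.dist_le q).trans ?_
        simpa using hp.le
      have h3 : G.dist v w ≤ G.dist v u + G.dist u w := hG.dist_triangle
      rw [SimpleGraph.dist_eq_one_iff_adj.2 h.symm, hw] at h3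
      rw [SimpleGraph.dist_comm] at h1
      omega
  -- The distance from `v` will be the enumeration: past the start, one of the at most two
  -- neighbours lies nearer to `v`, leaving one farther away.
  have hinj : ∀ n w w', G.dist v w = n → G.dist v w' = n → w = w' := by
    intro n
    induction n with
    | zero =>
      intro w w' hw hw'
      rw [hG.dist_eq_zero_iff] at hw hw'
      rw [← hw, ← hw']
    | succ n ih =>
      intro w w' hw hw'
      obtain ⟨u, hu, huw⟩ := hpred n w hw
      obtain ⟨u', hu', huw'⟩ := hpred n w' hw'
      obtain rfl := ih u u' hu hu'
      cases n with
      | zero =>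
        obtain rfl := hG.dist_eq_zero_iff.1 hu
        exact hv _ _ huw huw'
      | succ n =>
        obtain ⟨x, hx, hxu⟩ := hpred n u hu
        rcases h2 u _ _ _ hxu.symm huw huw' with rfl | rfl | h
        · omega
        · omega
        · exact h
  have hdinj : Function.Injective (G.dist v) := fun w w' h => hinj _ w w' rfl h.symm
  have hdsurj : Function.Surjective (G.dist v) := by
    intro n
    by_contra hn
    push Not at hn
    have hall : ∀ k w, G.dist v w ≠ n + k := by
      intro k
      induction k with
      | zero => exact hn
      | succ k ih =>
        intro w hw
        obtain ⟨u, hu, -⟩ := hpred _ w hw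
        exact ih u hu
    have hlt : ∀ w, G.dist v w ∈ Iio n := fun w => by
      by_contra h
      exact hall (G.dist v w - n) w (by simp at h; omega)
    exact not_injective_infinite_finite (fun w => (⟨_, hlt w⟩ : Iio n))
      fun w w' h => hdinj (congrArg Subtype.val h)
  let e := Equiv.ofBijective _ ⟨hdinj, hdsurj⟩
  have he : ∀ n, G.dist v (e.symm n) = n := fun n => e.apply_symm_apply n
  refine ⟨e.symm, e.symm.bijective, fun n => ?_⟩
  obtain ⟨u, hu, h⟩ := hpred n _ (he (n + 1))
  rwa [← hinj n _ _ hu (he n)]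

/-- An infinite connected graph in which every vertex has exactly two neighbours is a two-way
infinite path. -/
lemma exists_line {V : Type*} [Infinite V] {G : SimpleGraph V} (hG : G.Connected)
    (h2 : AtMostTwo G) (hv : ∀ v, ∃ a b, a ≠ b ∧ G.Adj v a ∧ G.Adj v b) :
    ∃ f : ℤ → V, f.Bijective ∧ ∀ n, G.Adj (f n) (f (n + 1)) := by
  -- Walking on without backtracking makes the successor a permutation of darts; reversing darts
  -- conjugates it to its inverse.
  have hnext : ∀ d : G.Dart, ∃ d' : G.Dart, d'.fst = d.snd ∧ d'.snd ≠ d.fst := by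
    intro d
    obtain ⟨a, b, hab, ha, hb⟩ := hv d.snd
    by_cases h : a = d.fst
    · exact ⟨⟨(d.snd, b), hb⟩, rfl, fun h' => hab (h.trans h'.symm)⟩
    · exact ⟨⟨(d.snd, a), ha⟩, rfl, h⟩
  choose nx hnx1 hnx2 using hnext
  have hext : ∀ d d' : G.Dart, d.fst = d'.fst → d.snd = d'.snd → d = d' := fun d d' h h' =>
    SimpleGraph.Dart.ext _ _ (Prod.ext h h')
  have hinv : ∀ d : G.Dart, (nx (nx d).symm).symm = d := by
    intro d
    have e1 : (nx (nx d).symm).fst = d.snd := by rw [hnx1, ← hnx1 d]; rfl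
    refine hext _ _ ?_ e1
    change (nx (nx d).symm).snd = d.fst
    have hne := hnx2 (nx d).symm
    have a1 : G.Adj d.snd (nx (nx d).symm).snd := e1 ▸ (nx (nx d).symm).adj
    have a2 : G.Adj d.snd (nx d).snd := hnx1 d ▸ (nx d).adj
    rcases h2 _ _ _ _ a1 a2 d.adj.symm with h | h | h
    · exact absurd h hne
    · exact h
    · exact absurd h (hnx2 d)
  let ρ : Equiv.Perm G.Dart := ⟨SimpleGraph.Dart.symm, SimpleGraph.Dart.symm,
    SimpleGraph.Dart.symm_symm, SimpleGraph.Dart.symm_symm⟩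
  let φ : Equiv.Perm G.Dart := ⟨nx, fun d => (nx d.symm).symm, hinv, fun d => by
    have h3 := congrArg SimpleGraph.Dart.symm (hinv d.symm)
    rwa [SimpleGraph.Dart.symm_symm, SimpleGraph.Dart.symm_symm] at h3⟩
  have hφ1 : ∀ d, (φ d).fst = d.snd := hnx1
  have hφ2 : ∀ d, (φ d).snd ≠ d.fst := hnx2
  have hρ : ρ * φ * ρ⁻¹ = φ⁻¹ := rfl
  have hρφ : ∀ (j : ℤ) d, (φ ^ j) (ρ d) = ρ ((φ ^ (-j)) d) := by
    intro j d
    have h : ρ * φ ^ (-j) * ρ⁻¹ = φ ^ j := by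
      rw [← conj_zpow, hρ, inv_zpow, zpow_neg, inv_inv]
    rw [← h]; simp
  have : Nonempty V := inferInstance
  obtain ⟨v⟩ := this
  obtain ⟨a, -, -, ha, -⟩ := hv v
  let d : G.Dart := ⟨(v, a), ha⟩
  let D : ℤ → G.Dart := fun n => (φ ^ n) d
  have hD : ∀ n, D (n + 1) = φ (D n) := fun n => by
    simp only [D]; rw [add_comm, zpow_add, zpow_one, Equiv.Perm.mul_apply]
  have hsnd : ∀ n, (D n).snd = (D (n + 1)).fst := fun n => by rw [hD, hφ1]
  have hadj : ∀ n, G.Adj (D n).fst (D (n + 1)).fst := fun n => hsnd n ▸ (D n).adj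
  have hne : ∀ n, (D (n + 2)).fst ≠ (D n).fst := fun n => by
    have := hφ2 (D n)
    rwa [← hD, hsnd, add_assoc] at this
  have hnb : ∀ n y, G.Adj (D n).fst y → y = (D (n + 1)).fst ∨ y = (D (n - 1)).fst := by
    intro n y hy
    have h1 := hadj (n - 1)
    have h3 := hne (n - 1)
    rw [show n - 1 + 2 = n + 1 by ring] at h3
    rw [sub_add_cancel] at h1
    rcases h2 _ _ _ _ hy (hadj n) h1.symm with h | h | h
    · exact Or.inl h
    · exact Or.inr h
    · exact absurd h h3
  have hsurj : Function.Surjective fun n => (D n).fst := by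
    refine eq_univ_of_adj_closed hG (S := range fun n => (D n).fst) ⟨_, 0, rfl⟩ ?_
    rintro _ ⟨n, rfl⟩ y hy
    rcases hnb n y hy with h | h
    · exact ⟨_, h.symm⟩
    · exact ⟨_, h.symm⟩
  refine ⟨fun n => (D n).fst, ⟨?_, hsurj⟩, hadj⟩
  have hlt : ∀ m n, m < n → (D m).fst ≠ (D n).fst := by
    intro m n hmn heq
    -- A revisited vertex is left either in the same direction, making the walk periodic and `V`
    -- finite, or in the opposite one.
    rcases hnb m (D n).snd (heq ▸ (D n).adj) with h | h
    · have hDD : D m = D n := hext _ _ heq (by rw [h, hsnd])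
      have hper : ∀ j, D (j + (n - m)) = D j := by
        intro j
        have e : ∀ i l, (φ ^ i) (D l) = D (i + l) := fun i l => by
          simp only [D]; rw [zpow_add, Equiv.Perm.mul_apply]
        have h4 := congrArg (φ ^ (j - m)) hDD
        rw [e, e] at h4
        rw [show j + (n - m) = j - m + n by ring, ← h4]; congr 1; ring
      have hper' : ∀ (l j : ℤ), D (j + l * (n - m)) = D j := by
        intro l
        induction l using Int.induction_on with
        | zero => simp
        | succ i ih => intro j; rw [add_mul, one_mul, ← add_assoc, hper, ih]
        | pred i ih =>
          intro j
          rw [← hper, ← ih j]; congr 1; ring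
      have hfin : (univ : Set V) ⊆ (fun i => (D i).fst) '' Ico 0 (n - m) := by
        intro w _
        obtain ⟨i, rfl⟩ := hsurj w
        refine ⟨i % (n - m), ⟨Int.emod_nonneg _ (by omega), Int.emod_lt_of_pos _ (by omega)⟩, ?_⟩
        have := hper' (i / (n - m)) (i % (n - m))
        rw [mul_comm, Int.emod_add_mul_ediv] at this
        simp only [this]
      exact infinite_univ (((finite_Ico _ _).image _).subset hfin)
    · have hrev : D n = ρ (D (m - 1)) := by
        refine hext _ _ ?_ h
        change (D n).fst = (D (m - 1)).snd
        rw [hsnd, sub_add_cancel, heq]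
      have hrev' : ∀ j, D (n + j) = ρ (D (m - 1 - j)) := by
        intro j
        have h4 := congrArg (φ ^ j) hrev
        rw [hρφ] at h4
        simp only [D] at h4 ⊢
        rw [← Equiv.Perm.mul_apply, ← zpow_add] at h4
        rw [add_comm n, h4, ← Equiv.Perm.mul_apply (φ ^ (-j)), ← zpow_add]; congr 3; ring
      -- Halfway along a walk retracing itself, a dart equals its own reverse (even case) or two
      -- consecutive darts backtrack (odd case).
      rcases Int.even_or_odd' (m - 1 - n) with ⟨j, hj | hj⟩
      · have h5 := hrev' j
        rw [show m - 1 - j = n + j by omega] at h5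
        exact (D (n + j)).symm_ne h5.symm
      · have h5 := hrev' j
        rw [show m - 1 - j = n + j + 1 by omega] at h5
        have h6 : (D (n + j)).fst = (D (n + j + 1)).snd := congrArg (fun d => d.fst) h5
        rw [hsnd] at h6
        exact hne (n + j) (by rw [h6]; congr 3; ring)
  intro m n h
  rcases lt_trichotomy m n with h' | h' | h'
  · exact absurd h (hlt m n h')
  · exact h'
  · exact absurd h.symm (hlt n m h')

end
end HeptagonTiling

/-! ### Enumerating the path and joining arcs. -/

namespace HeptagonTiling
noncomputable section

open ComplexConjugate

/-- A path-like infinite graph, enumerated by the integers or the nonnegative integers. -/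
lemma exists_path {V : Type*} [Infinite V] {G : SimpleGraph V} (hG : G.Connected)
    (h2 : AtMostTwo G) : ∃ (J : Set ℤ) (f : ℤ → V), (J = Ici 0 ∨ J = univ) ∧ InjOn f J ∧
      (∀ v, ∃ i ∈ J, f i = v) ∧ ∀ i ∈ J, G.Adj (f i) (f (i + 1)) := by
  by_cases h : ∃ v, ∀ a b, G.Adj v a → G.Adj v b → a = b
  · obtain ⟨v, hv⟩ := h
    obtain ⟨f, hf, hadj⟩ := exists_ray hG h2 hv
    refine ⟨Ici 0, fun i => f i.toNat, Or.inl rfl, ?_, ?_, ?_⟩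
    · intro i hi j hj hij
      have := hf.1 hij
      simp only [mem_Ici] at hi hj
      omega
    · intro w
      obtain ⟨n, rfl⟩ := hf.2 w
      exact ⟨n, by simp, by simp⟩
    · intro i hi
      simp only [mem_Ici] at hi ⊢
      have : (i + 1).toNat = i.toNat + 1 := by omega
      rw [this]
      exact hadj _
  · push Not at h
    obtain ⟨f, hf, hadj⟩ := exists_line hG h2 fun v => by
      obtain ⟨a, b, ha, hb, hab⟩ := h v
      exact ⟨a, b, hab, ha, hb⟩
    exact ⟨univ, f, Or.inr rfl, hf.1.injOn, fun v => (hf.2 v).imp fun i hi => ⟨trivial, hi⟩,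
      fun i _ => hadj i⟩

/-- Concatenation of a sequence of arcs. -/
lemma isSelfAvoidingCurve_concat {J : Set ℤ} (hJ : J = Ici 0 ∨ J = univ) {q : ℤ → ℝ → ℂ}
    (hc : ∀ i ∈ J, ContinuousOn (q i) (Icc 0 1)) (hq : ∀ i ∈ J, q i 1 = q (i + 1) 0)
    (hinj : ∀ i ∈ J, ∀ j ∈ J, ∀ s ∈ Ico (0 : ℝ) 1, ∀ t ∈ Ico (0 : ℝ) 1, q i s = q j t →
      i = j ∧ s = t) : IsSelfAvoidingCurve (⋃ i ∈ J, q i '' Icc 0 1) := by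
  obtain ⟨I, hI, hIJ⟩ : ∃ I : Set ℝ, (I = Ici 0 ∨ I = univ) ∧ ∀ s, s ∈ I ↔ ⌊s⌋ ∈ J := by
    rcases hJ with rfl | rfl
    · exact ⟨Ici 0, Or.inl rfl, fun s => by simp [Int.floor_nonneg]⟩
    · exact ⟨univ, Or.inr rfl, fun s => by simp⟩
  have hsucc : ∀ i ∈ J, i + 1 ∈ J := by
    rcases hJ with rfl | rfl
    · intro i hi; simp only [mem_Ici] at hi ⊢; omega
    · simp
  have hfl : ∀ s : ℝ, Int.fract s ∈ Ico (0 : ℝ) 1 := fun s => ⟨Int.fract_nonneg s, Int.fract_lt_one s⟩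
  have hδ : ∀ i ∈ J, EqOn (fun s => q ⌊s⌋ (Int.fract s)) (fun s => q i (s - i)) (Icc (i : ℝ) (i + 1)) := by
    intro i hi s hs
    rcases hs.2.lt_or_eq with h | h
    · have hf : ⌊s⌋ = i := Int.floor_eq_iff.2 ⟨hs.1, h⟩
      simp only [Int.fract, hf]
    · have hf : ⌊s⌋ = i + 1 := by rw [h]; simp
      have hs' : s - i = 1 := by rw [h]; ring
      have hs'' : s - ((i + 1 : ℤ) : ℝ) = 0 := by rw [h]; push_cast; ring
      simp only [Int.fract, hf, hs', hs'']
      exact (hq i hi).symm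
  have hIu : I = ⋃ i : J, Icc (i : ℝ) (i + 1) := by
    ext s
    rw [hIJ, mem_iUnion]
    constructor
    · exact fun h => ⟨⟨_, h⟩, Int.floor_le s, (Int.lt_floor_add_one s).le⟩
    · rintro ⟨⟨i, hi⟩, h⟩
      rcases h.2.lt_or_eq with h' | h'
      · rwa [Int.floor_eq_iff.2 ⟨h.1, h'⟩]
      · rw [h']; simpa using hsucc i hi
  refine ⟨I, fun s => q ⌊s⌋ (Int.fract s), hI, ?_, ?_, ?_⟩
  -- Continuity is checked on the unit intervals, which form a locally finite closed cover; the
  -- right endpoints are handled by the matching condition `hq`.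
  · rw [hIu]
    have hlf : LocallyFinite fun i : ℤ => Icc (i : ℝ) (i + 1) :=
      locallyFinite_Icc_of_tendsto tendsto_intCast_atTop_atTop
        (Filter.tendsto_atBot_add_const_right _ _ (tendsto_intCast_atBot_iff.2 Filter.tendsto_id))
    refine (hlf.comp_injective (g := ((↑) : J → ℤ)) Subtype.val_injective).continuousOn_iUnion
      (fun _ => isClosed_Icc) ?_
    rintro ⟨i, hi⟩
    refine ContinuousOn.congr ?_ (hδ i hi)
    refine (hc i hi).comp (by fun_prop) fun s hs => ⟨?_, ?_⟩
    · linarith [hs.1]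
    · linarith [hs.2]
  · intro s hs t ht hst
    obtain ⟨h1, h2⟩ := hinj _ ((hIJ s).1 hs) _ ((hIJ t).1 ht) _ (hfl s) _ (hfl t) hst
    rw [← Int.floor_add_fract s, ← Int.floor_add_fract t, h1, h2]
  · ext p
    simp only [mem_image, mem_iUnion]
    constructor
    · rintro ⟨s, hs, rfl⟩
      exact ⟨_, (hIJ s).1 hs, _, ⟨(hfl s).1, (hfl s).2.le⟩, rfl⟩
    · rintro ⟨i, hi, t, ht, rfl⟩
      have hm : t + i ∈ Icc (i : ℝ) (i + 1) := ⟨by linarith [ht.1], by linarith [ht.2]⟩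
      refine ⟨t + i, ?_, ?_⟩
      · rw [hIu, mem_iUnion]; exact ⟨⟨i, hi⟩, hm⟩
      · have := hδ i hi hm
        simp only [add_sub_cancel_right] at this
        exact this

/-! ### The port graph of a tiling and nonperiodicity. -/

/-- The graph of tiles whose copies of the point set `S` have a common point. -/
def portGraph (S : Set ℂ) (g : ℕ → ℂ ≃ᵢ ℂ) : SimpleGraph ℕ where
  Adj m n := m ≠ n ∧ (g m '' S ∩ g n '' S).Nonempty
  symm := ⟨fun m n h => ⟨h.1.symm, by rw [inter_comm]; exact h.2⟩⟩
  loopless := ⟨fun _ h => h.1 rfl⟩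

lemma portGraph_connected {g : ℕ → ℂ ≃ᵢ ℂ} (hR1 : RuleR1 g) : (portGraph arcEnds g).Connected := by
  have h : ∀ n, (portGraph arcEnds g).Reachable n 0 := by
    intro n
    induction n using Nat.strong_induction_on with
    | _ n ih =>
      rcases Nat.eq_zero_or_pos n with rfl | hn
      · rfl
      · obtain ⟨m, hm, hne⟩ := hR1 n hn
        have hadj : (portGraph arcEnds g).Adj n m := ⟨hm.ne', hne⟩
        exact hadj.reachable.trans (ih m hm)
  exact ⟨fun m n => (h m).trans (h n).symm⟩

/-- Connectedness comes from the arc ends, but a translation may carry a tile onto a flipped copy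
and only respects all three ports; this inclusion links the two graphs. -/
lemma portGraph_mono (g : ℕ → ℂ ≃ᵢ ℂ) : portGraph arcEnds g ≤ portGraph ports g := by
  intro m n h
  exact ⟨h.1, h.2.mono (inter_subset_inter (image_mono arcEnds_subset_ports)
    (image_mono arcEnds_subset_ports))⟩

section

variable {g : ℕ → ℂ ≃ᵢ ℂ}

lemma IsTiling.interior_eq_empty (hg : IsTiling tile g) {m n : ℕ} (h : m ≠ n) :
    interior (g m '' tile ∩ g n '' tile) = ∅ :=
  (isOpen_interior.measure_eq_zero_iff volume).1
    (measure_mono_null interior_subset (hg.no_overlap m n h))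

lemma IsTiling.no_three (hg : IsTiling tile g) {l m n : ℕ} (hlm : l ≠ m) (hln : l ≠ n)
    (hmn : m ≠ n) {p : ℂ} (hl : p ∈ g l '' ports) (hm : p ∈ g m '' ports)
    (hn : p ∈ g n '' ports) : False := by
  obtain ⟨i, j, hij, h⟩ := ports_two_of_three (g := fun i => g (![l, m, n] i)) (p := p)
    (fun i => by fin_cases i <;> assumption)
  refine h.ne_empty (hg.interior_eq_empty ?_)
  fin_cases i <;> fin_cases j <;> simp_all [Ne.symm]

/-- At most one neighbour sits at `hept 0`, by `no_three`, and at most one in the notch, by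
`no_three` within a corner and `notch_overlap` across the two. -/
lemma IsTiling.atMostTwo (hg : IsTiling tile g) : AtMostTwo (portGraph ports g) := by
  intro v
  have hcorner : ∀ a b, v ≠ a → v ≠ b → g v (hept 0) ∈ g a '' ports →
      g v (hept 0) ∈ g b '' ports → a = b := by
    intro a b hva hvb ha hb
    by_contra hab
    exact hg.no_three hva hvb hab (mem_image_of_mem _ (by simp [ports])) ha hb
  have hnotch : ∀ a b, v ≠ a → v ≠ b →
      (g v (refl 3) ∈ g a '' ports ∨ g v (refl (-3)) ∈ g a '' ports) →
      (g v (refl 3) ∈ g b '' ports ∨ g v (refl (-3)) ∈ g b '' ports) → a = b := by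
    intro a b hva hvb ha hb
    by_contra hab
    have hv := hg.interior_eq_empty hva
    have hv' := hg.interior_eq_empty hvb
    rcases ha with ha | ha <;> rcases hb with hb | hb
    · exact hg.no_three hva hvb hab (mem_image_of_mem _ (by simp [ports])) ha hb
    · exact (notch_overlap ha hb hv hv').ne_empty (hg.interior_eq_empty hab)
    · exact (notch_overlap hb ha hv' hv).ne_empty (hg.interior_eq_empty (Ne.symm hab))
    · exact hg.no_three hva hvb hab (mem_image_of_mem _ (by simp [ports])) ha hb
  have hcl : ∀ a, (portGraph ports g).Adj v a → v ≠ a ∧ (g v (hept 0) ∈ g a '' ports ∨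
      (g v (refl 3) ∈ g a '' ports ∨ g v (refl (-3)) ∈ g a '' ports)) := by
    rintro a ⟨hva, _, ⟨q, hq, rfl⟩, hpa⟩
    refine ⟨hva, ?_⟩
    rcases hq with rfl | rfl | rfl <;> tauto
  intro a b c ha hb hc
  obtain ⟨hva, ha⟩ := hcl a ha
  obtain ⟨hvb, hb⟩ := hcl b hb
  obtain ⟨hvc, hc⟩ := hcl c hc
  rcases ha with ha | ha <;> rcases hb with hb | hb
  · exact Or.inl (hcorner a b hva hvb ha hb)
  · rcases hc with hc | hc
    · exact Or.inr (Or.inl (hcorner a c hva hvc ha hc))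
    · exact Or.inr (Or.inr (hnotch b c hvb hvc hb hc))
  · rcases hc with hc | hc
    · exact Or.inr (Or.inr (hcorner b c hvb hvc hb hc))
    · exact Or.inr (Or.inl (hnotch a c hva hvc ha hc))
  · exact Or.inl (hnotch a b hva hvb ha hb)

lemma interior_tile_nonempty : (interior tile).Nonempty := by
  have hz : Real.cos (5 * Real.pi / 14) * ‖cis Real.pi‖ <
      (cis Real.pi * conj (cis Real.pi)).re := by
    rw [Complex.mul_conj, Complex.normSq_eq_norm_sq, norm_cis]
    have := cos_five_pi_div.2
    simp only [mul_one, one_pow, Complex.ofReal_one, Complex.one_re]; linarith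
  simpa using tile_hasSector_zero.interior_inter tile_hasSector_zero hz hz

lemma IsTiling.tile_injective (hg : IsTiling tile g) {m n : ℕ} (h : g m '' tile = g n '' tile) :
    m = n := by
  by_contra hmn
  have := hg.interior_eq_empty hmn
  rw [h, inter_self, interior_image, image_eq_empty] at this
  exact interior_tile_nonempty.ne_empty this

/-- Translations of tiles move their arc ends and centres along. -/
lemma ports_of_translate {t u : ℂ ≃ᵢ ℂ} {τ : ℂ}
    (h : (fun z => z + τ) '' (t '' tile) = u '' tile) :
    u 0 = t 0 + τ ∧ u '' ports = (fun z => z + τ) '' (t '' ports) := by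
  set k := (t.trans (IsometryEquiv.addRight τ)).trans u.symm with hk
  have hks : ∀ s, k '' s = u.symm '' ((fun z => z + τ) '' (t '' s)) := fun s => by
    rw [image_image, image_image]; rfl
  have hus : ∀ s : Set ℂ, u '' (u.symm '' s) = s := fun s => by
    rw [image_image]; simp
  have hT : k '' tile = tile := by
    rw [hks, h, image_image]; simp
  obtain ⟨h0, hp⟩ := symmetry_of_tile hT
  constructor
  · have := congrArg u h0
    rw [← this, hk]; simp
  · conv_lhs => rw [← hp, hks, hus]

lemma IsTiling.nonperiodic (hg : IsTiling tile g) (hR1 : RuleR1 g) :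
    Nonperiodic (range fun n => g n '' tile) := by
  intro τ hτ heq
  have hσ : ∀ n, ∃ m, (fun z => z + τ) '' (g n '' tile) = g m '' tile := fun n => by
    have : (fun z => z + τ) '' (g n '' tile) ∈ range fun n => g n '' tile :=
      heq ▸ mem_image_of_mem _ ⟨n, rfl⟩
    obtain ⟨m, hm⟩ := this
    exact ⟨m, hm.symm⟩
  have hσ' : ∀ m, ∃ n, (fun z => z + τ) '' (g n '' tile) = g m '' tile := fun m => by
    have : g m '' tile ∈ (fun S : Set ℂ => (fun z => z + τ) '' S) '' range fun n => g n '' tile :=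
      heq.symm ▸ ⟨m, rfl⟩
    obtain ⟨_, ⟨n, rfl⟩, hn⟩ := this
    exact ⟨n, hn⟩
  choose s hs using hσ
  choose s' hs' using hσ'
  have hinj : Function.Injective fun S : Set ℂ => (fun z => z + τ) '' S :=
    image_injective.2 (add_left_injective τ)
  let σ : Equiv.Perm ℕ := ⟨s, s', fun n => hg.tile_injective (hinj ((hs' (s n)).trans (hs n).symm)),
    fun m => hg.tile_injective ((hs (s' m)).symm.trans (hs' m))⟩
  have hc : ∀ n, g (σ n) 0 = g n 0 + τ := fun n => (ports_of_translate (hs n)).1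
  have hp : ∀ n, g (σ n) '' ports = (fun z => z + τ) '' (g n '' ports) := fun n =>
    (ports_of_translate (hs n)).2
  obtain ⟨F, hF, horb⟩ := exists_finite_orbits ((portGraph_connected hR1).mono (portGraph_mono g))
    hg.atMostTwo σ (fun m n => by
      change (σ m ≠ σ n ∧ _) ↔ (m ≠ n ∧ _)
      rw [hp, hp, ← image_inter (add_left_injective τ), image_nonempty, σ.injective.ne_iff])
    (fun n h => hτ (by have := hc n; rw [h] at this; simpa using this))
    (fun n h => hτ (by
      have := hc (σ n)
      rw [h, hc, add_assoc, left_eq_add, ← two_mul] at this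
      simpa using this))
  -- A coordinate normal to τ, constant on σ-orbits of centres. Finitely many orbits and tiles of
  -- radius at most 1 would bound it on the whole plane.
  let L : ℂ → ℝ := fun z => (z * conj τ).im
  have hLτ : L τ = 0 := by simp [L]; ring
  have hLadd : ∀ z w, L (z + w) = L z + L w := fun z w => by simp only [L, add_mul, Complex.add_im]
  have hLσ : ∀ (m : ℤ) n, L (g ((σ ^ m) n) 0) = L (g n 0) := by
    intro m
    induction m using Int.induction_on with
    | zero => simp
    | succ i ih =>
      intro n
      rw [zpow_add_one, Equiv.Perm.mul_apply, ih, hc, hLadd, hLτ, add_zero]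
    | pred i ih =>
      intro n
      rw [zpow_sub_one, Equiv.Perm.mul_apply, ih]
      have := hc (σ⁻¹ n)
      rw [← Equiv.Perm.mul_apply, mul_inv_cancel, Equiv.Perm.one_apply] at this
      rw [this, hLadd, hLτ, add_zero]
  obtain ⟨M, hM⟩ := (hF.image fun n => L (g n 0)).bddAbove
  have hbound : ∀ z, L z ≤ M + ‖τ‖ := by
    intro z
    have hz : z ∈ ⋃ n, g n '' tile := hg.covers ▸ mem_univ z
    obtain ⟨n, w, hw, rfl⟩ := mem_iUnion.1 hz
    obtain ⟨f, hf, m, rfl⟩ := horb n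
    have h1 : L (g ((σ ^ m) f) 0) ≤ M := hLσ m f ▸ hM (mem_image_of_mem _ hf)
    have h2 : ‖g ((σ ^ m) f) w - g ((σ ^ m) f) 0‖ ≤ 1 := by
      rw [← dist_eq_norm, (g _).isometry.dist_eq]
      exact tile_subset_closedBall hw
    have h3 : L (g ((σ ^ m) f) w - g ((σ ^ m) f) 0) ≤ ‖τ‖ := by
      refine (Complex.abs_im_le_norm _ |> (le_abs_self _).trans).trans ?_
      rw [norm_mul, RCLike.norm_conj]
      exact mul_le_of_le_one_left (norm_nonneg _) h2
    have h4 := hLadd (g ((σ ^ m) f) 0) (g ((σ ^ m) f) w - g ((σ ^ m) f) 0)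
    rw [add_sub_cancel] at h4
    linarith
  have hn : 0 < ‖τ‖ ^ 2 := by positivity
  have := hbound (((M + ‖τ‖ + 1) / ‖τ‖ ^ 2 : ℝ) * (Complex.I * τ))
  have e : L (((M + ‖τ‖ + 1) / ‖τ‖ ^ 2 : ℝ) * (Complex.I * τ)) = M + ‖τ‖ + 1 := by
    simp only [L]
    rw [mul_assoc, Complex.im_ofReal_mul, mul_assoc, Complex.mul_conj, Complex.normSq_eq_norm_sq,
      Complex.I_mul_im, Complex.ofReal_re]
    field_simp
  linarith

/-! ### The curve of marked arcs. -/

/-- A non-end point of the first arc is interior to its tile, while the other arc lies in the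
closure of the interior of its own tile; the two interiors would meet. -/
lemma IsMarkedArc.mem_arcEnds {a : Set ℂ} (ha : IsMarkedArc a) (hg : IsTiling tile g) {m n : ℕ}
    (hmn : m ≠ n) {p : ℂ} (hm : p ∈ g m '' a) (hn : p ∈ g n '' a) : p ∈ g m '' arcEnds := by
  obtain ⟨γ, hc, -, rfl, h0, h1, hint⟩ := ha
  obtain ⟨_, ⟨s, hs, rfl⟩, rfl⟩ := hm
  by_cases hs0 : s = 0
  · exact mem_image_of_mem _ (by rw [hs0, h0]; simp [arcEnds])
  by_cases hs1 : s = 1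
  · exact mem_image_of_mem _ (by rw [hs1, h1]; simp [arcEnds])
  exfalso
  have hsi : γ s ∈ interior tile := hint (mem_image_of_mem _
    ⟨lt_of_le_of_ne hs.1 (Ne.symm hs0), lt_of_le_of_ne hs.2 hs1⟩)
  have hcl : γ '' Icc 0 1 ⊆ closure (interior tile) := by
    rw [← closure_Ioo (zero_ne_one' ℝ)] at hc ⊢
    exact hc.image_closure.trans (closure_mono hint)
  have hn' : g m (γ s) ∈ closure (g n '' interior tile) := by
    have : closure (g n '' interior tile) = g n '' closure (interior tile) :=
      ((g n).toHomeomorph.image_closure _).symm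
    rw [this]
    exact image_mono hcl hn
  have ho : IsOpen (g m '' interior tile) := by rw [← interior_image]; exact isOpen_interior
  obtain ⟨x, hx⟩ := mem_closure_iff.1 hn' _ ho (mem_image_of_mem _ hsi)
  have hx' : x ∈ interior (g m '' tile ∩ g n '' tile) := by
    rwa [interior_inter, interior_image, interior_image]
  rw [hg.interior_eq_empty hmn] at hx'
  exact hx'

lemma IsMarkedArc.exists_param {a : Set ℂ} (ha : IsMarkedArc a) (t : ℂ ≃ᵢ ℂ) {x y : ℂ}
    (hx : x ∈ t '' arcEnds) (hy : y ∈ t '' arcEnds) (hxy : x ≠ y) :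
    ∃ q : ℝ → ℂ, ContinuousOn q (Icc 0 1) ∧ InjOn q (Icc 0 1) ∧ q '' Icc 0 1 = t '' a ∧
      q 0 = x ∧ q 1 = y := by
  obtain ⟨γ, hc, hi, rfl, h0, h1, -⟩ := ha
  have hc' : ContinuousOn (fun s => t (γ s)) (Icc 0 1) := t.continuous.comp_continuousOn hc
  have hi' : InjOn (fun s => t (γ s)) (Icc 0 1) := t.injective.comp_injOn hi
  have hm : MapsTo (fun s : ℝ => 1 - s) (Icc 0 1) (Icc 0 1) := fun s hs =>
    ⟨by linarith [hs.2], by linarith [hs.1]⟩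
  simp only [arcEnds, image_insert_eq, image_singleton, mem_insert_iff, mem_singleton_iff] at hx hy
  rcases hx with rfl | rfl <;> rcases hy with rfl | rfl
  · exact absurd rfl hxy
  · exact ⟨fun s => t (γ s), hc', hi', by rw [image_image], by simp only [h0], by simp only [h1]⟩
  · refine ⟨fun s => t (γ (1 - s)), hc'.comp (by fun_prop) hm,
      hi'.comp (sub_right_injective.injOn) hm, ?_, by simp [h1], by simp [h0]⟩
    rw [image_image]
    ext p
    constructor
    · rintro ⟨s, hs, rfl⟩
      exact ⟨1 - s, hm hs, rfl⟩
    · rintro ⟨s, hs, rfl⟩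
      exact ⟨1 - s, hm hs, by simp⟩
  · exact absurd rfl hxy

lemma IsTiling.isSelfAvoidingCurve {a : Set ℂ} (ha : IsMarkedArc a) (hg : IsTiling tile g)
    (hR1 : RuleR1 g) : IsSelfAvoidingCurve (⋃ n, g n '' a) := by
  have h2 : AtMostTwo (portGraph arcEnds g) := fun v a b c ha hb hc =>
    hg.atMostTwo v a b c (portGraph_mono g ha) (portGraph_mono g hb) (portGraph_mono g hc)
  have hthree : ∀ {l m n : ℕ} {p : ℂ}, l ≠ m → l ≠ n → m ≠ n → p ∈ g l '' arcEnds →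
      p ∈ g m '' arcEnds → p ∈ g n '' arcEnds → False := fun h1 h2 h3 hl hm hn =>
    hg.no_three h1 h2 h3 (image_mono arcEnds_subset_ports hl)
      (image_mono arcEnds_subset_ports hm) (image_mono arcEnds_subset_ports hn)
  obtain ⟨J, f, hJ, hinj, hsurj, hadj⟩ := exists_path (portGraph_connected hR1) h2
  have hup : ∀ i ∈ J, ∀ j, i ≤ j → j ∈ J := by
    rcases hJ with rfl | rfl
    · intro i hi j hij; exact le_trans hi hij
    · simp
  have hne : ∀ i ∈ J, ∀ j ∈ J, i ≠ j → f i ≠ f j := fun i hi j hj hij h => hij (hinj hi hj h)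
  -- `y i` joins arc `i` to arc `i + 1`; the value 0 outside `J` is irrelevant.
  have hy : ∀ i, ∃ y, i ∈ J → y ∈ g (f i) '' arcEnds ∧ y ∈ g (f (i + 1)) '' arcEnds := fun i => by
    by_cases hi : i ∈ J
    · obtain ⟨-, y, hy⟩ := hadj i hi
      exact ⟨y, fun _ => hy⟩
    · exact ⟨0, fun h => absurd h hi⟩
  choose y hy using hy
  have hother : ∀ i, ∃ z ∈ g (f i) '' arcEnds, z ≠ y i := fun i => by
    by_cases h : g (f i) (hept 0) = y i
    · refine ⟨g (f i) (refl 3), mem_image_of_mem _ (by simp [arcEnds]), fun h' => ?_⟩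
      exact refl_three_ne.1 ((g (f i)).injective (h'.trans h.symm))
    · exact ⟨_, mem_image_of_mem _ (by simp [arcEnds]), h⟩
  choose z hz hzy using hother
  classical
  -- Starting point of arc `i`: the junction with its predecessor or, for the first arc of a ray,
  -- the end not used by its successor.
  let x : ℤ → ℂ := fun i => if i - 1 ∈ J then y (i - 1) else z i
  have hx1 : ∀ i ∈ J, x (i + 1) = y i := fun i hi => by
    simp only [x, add_sub_cancel_right, if_pos hi]
  have hxm : ∀ i ∈ J, x i ∈ g (f i) '' arcEnds := fun i hi => by
    by_cases h : i - 1 ∈ J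
    · have := (hy _ h).2
      simp only [x, if_pos h]
      rwa [sub_add_cancel] at this
    · simp only [x, if_neg h]; exact hz i
  have hxm' : ∀ i ∈ J, x (i + 1) ∈ g (f i) '' arcEnds := fun i hi => hx1 i hi ▸ (hy i hi).1
  -- Equality would put three consecutive tiles at one port; for a first arc it contradicts the
  -- choice of `z`.
  have hxne : ∀ i ∈ J, x i ≠ x (i + 1) := fun i hi h => by
    by_cases h' : i - 1 ∈ J
    · have hi1 := hup i hi (i + 1) (by omega)
      have h3 := hxm' _ h'
      rw [sub_add_cancel] at h3
      exact hthree (hne _ h' _ hi (by omega)) (hne _ h' _ hi1 (by omega))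
        (hne _ hi _ hi1 (by omega)) h3 (hxm i hi) (h ▸ hxm _ hi1)
    · rw [hx1 i hi] at h
      simp only [x, if_neg h'] at h
      exact hzy i h
  have hq : ∀ i, ∃ q : ℝ → ℂ, i ∈ J → ContinuousOn q (Icc 0 1) ∧ InjOn q (Icc 0 1) ∧
      q '' Icc 0 1 = g (f i) '' a ∧ q 0 = x i ∧ q 1 = x (i + 1) := fun i => by
    by_cases hi : i ∈ J
    · obtain ⟨q, h⟩ := ha.exists_param (g (f i)) (hxm i hi) (hxm' i hi) (hxne i hi)
      exact ⟨q, fun _ => h⟩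
    · exact ⟨0, fun h => absurd h hi⟩
  choose q hq using hq
  have hends : ∀ i ∈ J, ∀ p ∈ g (f i) '' arcEnds, p = x i ∨ p = x (i + 1) := by
    intro i hi p hp
    have h1 := hxm i hi
    have h2 := hxm' i hi
    have h3 := hxne i hi
    simp only [arcEnds, image_insert_eq, image_singleton, mem_insert_iff, mem_singleton_iff]
      at hp h1 h2
    rcases h1 with h1 | h1 <;> rcases h2 with h2 | h2
    · exact absurd (h1.trans h2.symm) h3
    · rw [h1, h2]; exact hp
    · rw [h1, h2]; exact hp.symm
    · exact absurd (h1.trans h2.symm) h3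
  have hstart : ∀ i ∈ J, ∀ j ∈ J, i ≠ j → ∀ s ∈ Ico (0 : ℝ) 1, ∀ t ∈ Ico (0 : ℝ) 1,
      q i s = q j t → q i s = x i := by
    intro i hi j hj hij s hs t ht h
    obtain ⟨-, hinji, himi, -, h1i⟩ := hq i hi
    obtain ⟨-, -, himj, -, -⟩ := hq j hj
    have hp := ha.mem_arcEnds hg (hne i hi j hj hij)
      (himi ▸ mem_image_of_mem _ (Ico_subset_Icc_self hs))
      (h ▸ himj ▸ mem_image_of_mem _ (Ico_subset_Icc_self ht))
    rcases hends i hi _ hp with h' | h'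
    · exact h'
    · rw [← h1i] at h'
      exact absurd (hinji (Ico_subset_Icc_self hs) (right_mem_Icc.2 zero_le_one) h') hs.2.ne
  -- For nonconsecutive `i < j`, a common starting point would be shared by the tiles `i`, `j - 1`
  -- and `j`.
  have hxlt : ∀ i ∈ J, ∀ j, i < j → x i ≠ x j := by
    intro i hi j hij h
    have hj := hup i hi j hij.le
    have hj1 := hup i hi (j - 1) (by omega)
    by_cases hij1 : j - 1 = i
    · exact hxne i hi (by rw [h, ← hij1, sub_add_cancel])
    · have h3 := hxm' _ hj1
      rw [sub_add_cancel] at h3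
      exact hthree (hne i hi _ hj1 (Ne.symm hij1)) (hne i hi j hj hij.ne)
        (hne _ hj1 j hj (by omega)) (h ▸ hxm i hi) h3 (hxm j hj)
  have hcurve := isSelfAvoidingCurve_concat hJ (q := q) (fun i hi => (hq i hi).1)
    (fun i hi => by
      rw [(hq i hi).2.2.2.2, (hq (i + 1) (hup i hi _ (by omega))).2.2.2.1])
    (fun i hi j hj s hs t ht h => by
      by_cases hij : i = j
      · subst hij
        exact ⟨rfl, (hq i hi).2.1 (Ico_subset_Icc_self hs) (Ico_subset_Icc_self ht) h⟩
      · exfalso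
        have h1 := hstart i hi j hj hij s hs t ht h
        have h3 := hstart j hj i hi (Ne.symm hij) t ht s hs h.symm
        have hxx : x i = x j := by rw [← h1, ← h3, h]
        rcases lt_or_gt_of_ne hij with hlt | hlt
        · exact hxlt i hi j hlt hxx
        · exact hxlt j hj i hlt hxx.symm)
  convert hcurve using 1
  ext p
  simp only [mem_iUnion]
  constructor
  · rintro ⟨n, hn⟩
    obtain ⟨i, hi, rfl⟩ := hsurj n
    exact ⟨i, hi, (hq i hi).2.2.1 ▸ hn⟩
  · rintro ⟨i, hi, hp⟩
    exact ⟨f i, (hq i hi).2.2.1 ▸ hp⟩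

lemma IsMarkedArc.inter_tile_nonempty {a : Set ℂ} (ha : IsMarkedArc a) (n : ℕ) :
    ((⋃ m, g m '' a) ∩ g n '' tile).Nonempty := by
  obtain ⟨γ, -, -, rfl, h0, -, -⟩ := ha
  exact ⟨g n (hept 0), mem_iUnion.2 ⟨n, mem_image_of_mem _ ⟨0, by simp, h0⟩⟩,
    mem_image_of_mem _ hept_mem_tile.1⟩

end

end
end HeptagonTiling

theorem mainTheorem2 (a : Set ℂ) (ha : HeptagonTiling.IsMarkedArc a) (g : ℕ → ℂ ≃ᵢ ℂ)
    (hg : HeptagonTiling.IsTiling HeptagonTiling.tile g) (hR1 : HeptagonTiling.RuleR1 g) :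
    HeptagonTiling.GeneratesCurve HeptagonTiling.tile a g ∧
      HeptagonTiling.Nonperiodic (Set.range fun n => g n '' HeptagonTiling.tile) :=
  ⟨⟨hg, hg.isSelfAvoidingCurve ha hR1, ha.inter_tile_nonempty⟩, hg.nonperiodic hR1⟩
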